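/- Let $X$ be a compact length space (a compact metric space in which $d(x,y)$ is the infimum of the lengths of the paths from $x$ to $y$), let $Y\subseteq X$ be closed and non-empty, let $F:Y\to\mathbb R$ be Lipschitz, and let $\beta>0$. Write $B_r(x)$ for the open ball. Let $\rho:[0,\infty)\to\mathbb R$ be an odds function: $\rho(0)=1$, $\rho(\epsilon)>0$ for $\epsilon>0$, and $\rho'(0)=\beta$ (one-sided derivative). For $\epsilon>0$ consider three two-player games started at $x_0\in X$. In each of them every step involves an independent coin toss, which player I wins with probability $\rho(\epsilon)/(\rho(\epsilon)+1)$; the game ends at the first $k\ge 0$ with $x_k\in Y$, and player II then pays $F(x_k)$ to player I. * Ordinary game: the winner of the $k$-th toss chooses $x_k\in B_\epsilon(x_{k-1})$. * II-favored game: at step $k$ player I first chooses $z_k\in B_\epsilon(x_{k-1})$. If player I wins the toss, player II chooses $x_k\in (B_{2\epsilon}(z_k)\cap Y)\cup\{z_k\}$; if player II wins the toss, he chooses $x_k\in B_{2\epsilon}(z_k)$. * I-favored game: the same with the roles of the players exchanged (player II chooses $z_k$; the coin is not changed). A strategy chooses a player's next move as a function of all previous tosses and moves. For strategies $S_I,S_{II}$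 let $F_-(S_I,S_{II})=F_+(S_I,S_{II})$ be the expected payoff if the game terminates almost surely, and let $F_-=-\infty$, $F_+=+\infty$ otherwise. The value for player I is $\sup_{S_I}\inf_{S_{II}}F_-$ and the value for player II is $\inf_{S_{II}}\sup_{S_I}F_+$, as functions of $x_0$. Let $u^\epsilon$ be the common value of the ordinary game for both players, $v^\epsilon$ the value for player I of the II-favored game, and $w^\epsilon$ the value for player II of the I-favored game. Then there is a constant $C>0$, depending only on $\beta,X,Y,F$, such that for every such $\rho$ there is $\epsilon_0>0$ such that for all $0<\epsilon<\epsilon_0$ the two values of the ordinary game coincide, $u^\epsilon,v^\epsilon,w^\epsilon$ are finite everywhere on $X$, and $$\|v^\epsilon-u^\epsilon\|_\infty\le C\,\epsilon ,\qquad \|w^\epsilon-u^\epsilon\|_\infty\le C\sqrt{\epsilon}.$$ -/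

import Mathlib

open Set MeasureTheory
open scoped NNReal ENNReal unitInterval Topology

namespace TugOfWar

/-- A metric space is a length space if the distance of any two points is the infimum of the
lengths of the continuous paths in `X` that join them. -/
def IsLengthSpace (X : Type*) [MetricSpace X] : Prop :=
  ∀ x y : X, edist x y = ⨅ γ : Path x y, eVariationOn (fun t : I => γ t) Set.univ

/-! ### Coin tosses

Throughout, the `k`-th coin toss is recorded as a `Bool`: `true` if player I wins the toss and
`false` if player II wins it. -/

/-- One toss of a coin which player I wins with odds `r` to `1`,
i.e. with probability `r / (r + 1)` (for `r > 0`). -/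
noncomputable def coin (r : ℝ) : Measure Bool :=
  ProbabilityTheory.bernoulliMeasure true false
    (Set.projIcc (0 : ℝ) 1 zero_le_one (r / (r + 1)))

/-- An infinite sequence of independent tosses of this coin. -/
noncomputable def tosses (r : ℝ) : Measure (ℕ → Bool) :=
  Measure.infinitePi fun _ : ℕ => coin r

/-! ### Payoffs -/

section Payoff

variable {X : Type*} (Y : Set X) (F : Y → ℝ)

/-- The payoff along one trajectory: `F` at the first position in `Y`
(and the irrelevant value `0` if `Y` is never reached). -/
noncomputable def payoff (x : ℕ → X) : ℝ :=
  open Classical in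
  if h : ∃ n, x n ∈ Y then F ⟨x (Nat.find h), Nat.find_spec h⟩ else 0

/-- `x ω n` is the position after `n` steps if the tosses are `ω`. -/
def TerminatesAS (r : ℝ) (x : (ℕ → Bool) → ℕ → X) : Prop :=
  ∀ᵐ ω ∂(tosses r), ∃ n, x ω n ∈ Y

/-- `F₋`: the expected payoff if the game terminates almost surely, and `-∞` otherwise. -/
noncomputable def payoffMinus (r : ℝ) (x : (ℕ → Bool) → ℕ → X) : EReal :=
  open Classical in
  if TerminatesAS Y r x then ((∫ ω, payoff Y F (x ω) ∂(tosses r) : ℝ) : EReal) else ⊥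

/-- `F₊`: the expected payoff if the game terminates almost surely, and `+∞` otherwise. -/
noncomputable def payoffPlus (r : ℝ) (x : (ℕ → Bool) → ℕ → X) : EReal :=
  open Classical in
  if TerminatesAS Y r x then ((∫ ω, payoff Y F (x ω) ∂(tosses r) : ℝ) : EReal) else ⊤

end Payoff

/-! ### The ordinary game -/

section Ordinary

variable {X : Type*} [MetricSpace X]

/-- The current position, for a history that lists the pairs (winner of the toss, new position)
of the steps played so far, the most recent step first. -/
def position (x₀ : X) : List (Bool × X) → X
  | [] => x₀
  | (_, x) :: _ => x

/-- A strategy (of either player) for the ordinary game started at `x₀`: the next move, to be made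
in case the player wins the next toss, as a function of all previous tosses and moves. -/
structure Strategy (ε : ℝ) (x₀ : X) where
  move : List (Bool × X) → X
  legal : ∀ h, dist (move h) (position x₀ h) < ε

/-- The first `n` steps of the ordinary game, given the strategies and the tosses. -/
def history {ε : ℝ} {x₀ : X} (S_I S_II : Strategy ε x₀) (ω : ℕ → Bool) : ℕ → List (Bool × X)
  | 0 => []
  | n + 1 =>
    (ω n, if ω n = true then S_I.move (history S_I S_II ω n)
      else S_II.move (history S_I S_II ω n)) :: history S_I S_II ω n

def trajectory {ε : ℝ} {x₀ : X} (S_I S_II : Strategy ε x₀) (ω : ℕ → Bool) (n : ℕ) : X :=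
  position x₀ (history S_I S_II ω n)

/-- The value of the ordinary game for player I. Here `r` are the odds for player I. -/
noncomputable def valueI (Y : Set X) (F : Y → ℝ) (r ε : ℝ) (x : X) : EReal :=
  ⨆ S_I : Strategy ε x, ⨅ S_II : Strategy ε x, payoffMinus Y F r (trajectory S_I S_II)

/-- The value of the ordinary game for player II. -/
noncomputable def valueII (Y : Set X) (F : Y → ℝ) (r ε : ℝ) (x : X) : EReal :=
  ⨅ S_II : Strategy ε x, ⨆ S_I : Strategy ε x, payoffPlus Y F r (trajectory S_I S_II)

end Ordinary

/-! ### The favored games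

One player, the *aimer*, is at a disadvantage; the other one is the *favored* player. In each step
the aimer first chooses a target `z` in the open `ε`-ball around the current position. Then the coin
is tossed. If the aimer wins, the favored player either accepts `z` as the new position or
terminates the game by moving to a point of `Y` in the open `2ε`-ball around `z`. If the favored
player wins, he moves to any point of the open `2ε`-ball around `z`. -/

section Favored

variable {X : Type*} [MetricSpace X]

/-- The current position, for a history that lists the triples
(winner of the toss, target, new position), the most recent step first. -/
def favPosition (x₀ : X) : List (Bool × X × X) → X
  | [] => x₀
  | (_, _, x) :: _ => x

/-- A strategy of the aimer: the next target as a function of all previous tosses and moves. -/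
structure AimerStrategy (ε : ℝ) (x₀ : X) where
  target : List (Bool × X × X) → X
  legal : ∀ h, dist (target h) (favPosition x₀ h) < ε

/-- A strategy of the favored player: the next position as a function of all previous tosses and
moves, the current target `z` and the current toss `c`. The parameter `aimer` is the
outcome of a toss that is a win for the aimer. -/
structure FavoredStrategy (Y : Set X) (ε : ℝ) (aimer : Bool) where
  move : List (Bool × X × X) → X → Bool → X
  legal_aimer_wins : ∀ h z c, c = aimer → (dist (move h z c) z < 2 * ε ∧ move h z c ∈ Y) ∨
    move h z c = z
  legal_favored_wins : ∀ h z c, c ≠ aimer → dist (move h z c) z < 2 * ε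

/-- The first `n` steps of the favored game, given the strategies and the tosses. -/
def favHistory {Y : Set X} {ε : ℝ} {x₀ : X} {aimer : Bool} (S : AimerStrategy ε x₀)
    (T : FavoredStrategy Y ε aimer) (ω : ℕ → Bool) : ℕ → List (Bool × X × X)
  | 0 => []
  | n + 1 =>
    (ω n, S.target (favHistory S T ω n),
      T.move (favHistory S T ω n) (S.target (favHistory S T ω n)) (ω n)) :: favHistory S T ω n

def favTrajectory {Y : Set X} {ε : ℝ} {x₀ : X} {aimer : Bool} (S : AimerStrategy ε x₀)
    (T : FavoredStrategy Y ε aimer) (ω : ℕ → Bool) (n : ℕ) : X :=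
  favPosition x₀ (favHistory S T ω n)

/-- The value for player I of the II-favored game: player I aims, player II is favored. -/
noncomputable def valueIIFavored (Y : Set X) (F : Y → ℝ) (r ε : ℝ) (x : X) : EReal :=
  ⨆ S_I : AimerStrategy ε x, ⨅ S_II : FavoredStrategy Y ε true,
    payoffMinus Y F r (favTrajectory S_I S_II)

/-- The value for player II of the I-favored game: player II aims, player I is favored. -/
noncomputable def valueIFavored (Y : Set X) (F : Y → ℝ) (r ε : ℝ) (x : X) : EReal :=
  ⨅ S_II : AimerStrategy ε x, ⨆ S_I : FavoredStrategy Y ε false,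
    payoffPlus Y F r (favTrajectory S_II S_I)

end Favored

end TugOfWar

/-! Everything is deduced from the dynamic programming equation `u x = p * supBall ε u x + (1 - p) *
infBall ε u x` off `Y`, with `p = r / (r + 1)`. A function that gains at least `δ > 0` per step in
this equation (a strict subsolution, `IsSub` with `δ > 0`) yields a strategy: play so that the
function increases by a fixed amount on average. Being bounded, it cannot increase forever, so the
game terminates almost surely against every opponent, and the expected payoff is at least the
initial value (`terminatesAS_and_le_integral`). The same holds for the aimer in a favored game with
`IsFavSub`, and for the minimizing player after a change of sign.

A solution `u` exists by Perron's method between two barriers. It need not be strict, but the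
solutions with running cost `δ` are, and they converge uniformly to `u` as `δ → 0`. This rests on a
comparison principle whose point is that `f + θ * f ^ 2` is strictly better than a subsolution
wherever `f` oscillates. Hence almost maximality of `f + θ * f ^ 2 - g` spreads from ball to ball
until it reaches `Y`.

For the favored games, let `f` be a strict subsolution of the ordinary game. The function `supBall ε
f`, lowered by a multiple of `ε`, survives the favored player's stronger moves: the aimer targets an
almost maximizer of `f`, and a point within `2 * ε` of the target is joined to it by a midpoint at
which the equation for `f` applies. Near `Y` this fails, and there exponential cones serve as
barriers; the maximum of the two is a strict favored subsolution (`Setting.exists_isFavSub`). The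
other inequality is easy, since a favored player can do at least as well as in the ordinary game.
All hypotheses are symmetric under exchanging the players (`Setting.neg`), so the argument gives an
error of order `ε` for both favored games, which is stronger than the `√ε` claimed for `w`. -/

namespace TugOfWar

/-! ### Length spaces -/

/-- On a path of length less than `a + b`, the intermediate value theorem gives a point at any
prescribed distance from `x` up to `dist x y`; what remains of the length bounds its distance from
`y`. -/
theorem IsLengthSpace.exists_between {X : Type*} [MetricSpace X] (hX : IsLengthSpace X) {x y : X}
    {a b : ℝ} (ha : 0 < a) (hb : 0 < b) (h : dist x y < a + b) :
    ∃ z, dist z x < a ∧ dist z y < b := by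
  by_cases hxa : dist x y < a
  · exact ⟨y, by rwa [dist_comm], by simpa using hb⟩
  have hlt : edist x y < ENNReal.ofReal (a + b) := by
    rw [edist_dist]
    exact (ENNReal.ofReal_lt_ofReal_iff (by positivity)).2 h
  rw [hX x y, iInf_lt_iff] at hlt
  obtain ⟨γ, hγ⟩ := hlt
  obtain ⟨l, hl⟩ : ∃ l : ℝ, eVariationOn (fun t : I => γ t) Set.univ = ENNReal.ofReal l ∧ 0 ≤ l :=
    ⟨_, (ENNReal.ofReal_toReal hγ.ne_top).symm, ENNReal.toReal_nonneg⟩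
  have hlab : l < a + b := by
    rw [hl.1] at hγ
    exact (ENNReal.ofReal_lt_ofReal_iff (by positivity)).1 hγ
  have key : ∀ t : I, dist x (γ t) + dist (γ t) y ≤ l := by
    intro t
    have h1 := eVariationOn.edist_le (fun t : I => γ t) (s := Set.Iic t) (x := 0) (y := t)
      (by simp) (by simp)
    have h2 := eVariationOn.edist_le (fun t : I => γ t) (s := Set.Ici t) (x := t) (y := 1)
      (by simp) (by simp [unitInterval.le_one'])
    have h3 := eVariationOn.add_le_union (fun t : I => γ t) (s := Set.Iic t) (t := Set.Ici t)
      (fun u hu v hv => le_trans hu hv)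
    rw [Set.Iic_union_Ici, hl.1] at h3
    have h4 := (add_le_add h1 h2).trans h3
    simp only [γ.source, γ.target, edist_dist] at h4
    rw [← ENNReal.ofReal_add dist_nonneg dist_nonneg] at h4
    exact (ENNReal.ofReal_le_ofReal_iff hl.2).1 h4
  -- The prescribed distance from `x`: below `a`, yet so large that the remaining length `l - s` is
  -- below `b`.
  obtain ⟨s, hs1, hs2⟩ : ∃ s, max (l - b) 0 < s ∧ s < a :=
    _root_.exists_between (max_lt (by linarith) ha)
  have hc : Continuous fun t : I => dist x (γ t) := by fun_prop
  obtain ⟨t, ht⟩ := mem_range_of_exists_le_of_exists_ge hc (c := s)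
    ⟨0, by simpa using (le_max_right _ _).trans hs1.le⟩ ⟨1, by simpa using by linarith⟩
  refine ⟨γ t, by rw [dist_comm]; linarith, ?_⟩
  have := key t
  have := le_max_left (l - b) 0
  linarith

/-! ### Tosses -/

instance isProbabilityMeasure_coin (r : ℝ) : IsProbabilityMeasure (coin r) := by
  unfold coin; infer_instance

instance isProbabilityMeasure_tosses (r : ℝ) : IsProbabilityMeasure (tosses r) := by
  unfold tosses; infer_instance

theorem integral_coin {r : ℝ} (hr : 0 < r) (f : Bool → ℝ) :
    ∫ c, f c ∂(coin r) = r / (r + 1) * f true + (1 - r / (r + 1)) * f false := by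
  have h : r / (r + 1) ∈ Set.Icc (0 : ℝ) 1 :=
    ⟨by positivity, (div_le_one (by positivity)).2 (by linarith)⟩
  rw [coin, ProbabilityTheory.integral_bernoulliMeasure, Set.projIcc_of_mem _ h]
  simp

theorem measurable_update_toss (n : ℕ) :
    Measurable fun z : (ℕ → Bool) × Bool => Function.update z.1 n z.2 := by
  refine measurable_pi_iff.2 fun i => ?_
  by_cases hi : i = n
  · subst hi; simpa using measurable_snd
  · simp only [Function.update_of_ne hi]
    exact (measurable_pi_apply i).comp measurable_fst

/-- Resampling one coordinate of an i.i.d. sequence preserves its law; it suffices to check finite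
boxes. -/
theorem map_update_tosses (r : ℝ) (n : ℕ) :
    ((tosses r).prod (coin r)).map (fun z => Function.update z.1 n z.2) = tosses r := by
  have hm := measurable_update_toss n
  refine Measure.eq_infinitePi _ fun s t ht => ?_
  classical
  have hpre : (fun z : (ℕ → Bool) × Bool => Function.update z.1 n z.2) ⁻¹' (Set.pi s t) =
      (Set.pi (s.erase n : Finset ℕ) t) ×ˢ (if n ∈ s then t n else Set.univ) := by
    ext ⟨ω, c⟩
    simp only [Set.mem_preimage, Set.mem_pi, Set.mem_prod, Finset.mem_coe, Finset.mem_erase]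
    constructor
    · intro h
      refine ⟨fun i hi => by simpa [Function.update_of_ne hi.1] using h i hi.2, ?_⟩
      split_ifs with hn
      · simpa using h n hn
      · trivial
    · rintro ⟨h1, h2⟩ i hi
      by_cases hin : i = n
      · subst hin
        simpa [hi] using h2
      · simpa [Function.update_of_ne hin] using h1 i ⟨hin, hi⟩
  rw [Measure.map_apply hm (MeasurableSet.pi s.countable_toSet fun i _ => ht i), hpre,
    Measure.prod_prod, tosses, Measure.infinitePi_pi _ fun i _ => ht i]
  split_ifs with hn
  · exact Finset.prod_erase_mul _ _ hn
  · rw [Finset.erase_eq_of_notMem hn, measure_univ, mul_one]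

theorem measurable_of_dependsOn {α : Type*} [MeasurableSpace α] {H : (ℕ → Bool) → α} {n : ℕ}
    (hH : DependsOn H (Set.Iio n)) : Measurable H := by
  let e : (Fin n → Bool) → ℕ → Bool := fun f i => if h : i < n then f ⟨i, h⟩ else true
  have : H = (H ∘ e) ∘ fun ω (i : Fin n) => ω i := by
    ext1 ω
    refine hH fun i hi => ?_
    have : i < n := hi
    simp [e, this]
  rw [this]
  exact (measurable_of_finite _).comp (measurable_pi_iff.2 fun i => measurable_pi_apply _)

/-- Averaging over the `n`-th toss alone plays the role of conditional expectation in the one-step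
estimates for the game. -/
theorem integral_tosses_eq {r : ℝ} (hr : 0 < r) {H : (ℕ → Bool) → ℝ} {m : ℕ}
    (hH : DependsOn H (Set.Iio m)) {B : ℝ} (hB : ∀ ω, |H ω| ≤ B) (n : ℕ) :
    ∫ ω, H ω ∂(tosses r) = ∫ ω, (r / (r + 1) * H (Function.update ω n true) +
      (1 - r / (r + 1)) * H (Function.update ω n false)) ∂(tosses r) := by
  have hm := measurable_update_toss n
  have hHm := measurable_of_dependsOn hH
  have hint : Integrable (fun z : (ℕ → Bool) × Bool => H (Function.update z.1 n z.2))
      ((tosses r).prod (coin r)) :=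
    Integrable.of_bound (hHm.comp hm).aestronglyMeasurable B (.of_forall fun z => hB _)
  conv_lhs => rw [← map_update_tosses r n]
  rw [integral_map hm.aemeasurable hHm.aestronglyMeasurable, integral_prod _ hint]
  exact integral_congr_ae (.of_forall fun ω => integral_coin hr _)

theorem DependsOn.update {α : Type*} {H : (ℕ → Bool) → α} {m : ℕ}
    (hH : DependsOn H (Set.Iio m)) (n : ℕ) (c : Bool) :
    DependsOn (fun ω => H (Function.update ω n c)) (Set.Iio m) := by
  intro ω ω' h
  refine hH fun i hi => ?_
  by_cases hin : i = n
  · subst hin; simp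
  · simpa [Function.update_of_ne hin] using h i hi

/-! ### Expected payoffs -/

section Payoff

variable {X : Type*} {Y : Set X} {F : Y → ℝ}

open Classical in
/-- The trajectory `x`, stopped when it reaches `Y`. -/
noncomputable def stopAt (Y : Set X) (x : ℕ → X) : ℕ → X
  | 0 => x 0
  | n + 1 => if stopAt Y x n ∈ Y then stopAt Y x n else x (n + 1)

theorem stopAt_eq_of_notMem {x : ℕ → X} {n : ℕ} (h : stopAt Y x n ∉ Y) : stopAt Y x n = x n := by
  cases n with
  | zero => rfl
  | succ n =>
    unfold stopAt at h ⊢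
    split_ifs at h ⊢ with h1
    · exact absurd h1 h
    · rfl

theorem stopAt_succ_of_mem {x : ℕ → X} {n : ℕ} (h : stopAt Y x n ∈ Y) :
    stopAt Y x (n + 1) = stopAt Y x n := by
  rw [stopAt, if_pos h]

theorem stopAt_succ_of_notMem {x : ℕ → X} {n : ℕ} (h : stopAt Y x n ∉ Y) :
    stopAt Y x (n + 1) = x (n + 1) := by
  rw [stopAt, if_neg h]

theorem forall_notMem_of_stopAt_notMem {x : ℕ → X} {n : ℕ} (h : stopAt Y x n ∉ Y) :
    ∀ k ≤ n, x k ∉ Y := by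
  induction n with
  | zero => intro k hk; rw [Nat.le_zero.1 hk]; exact h
  | succ n ih =>
    have hn : stopAt Y x n ∉ Y := fun h' => h (by rwa [stopAt_succ_of_mem h'])
    intro k hk
    rcases Nat.le_succ_iff.1 hk with hk | rfl
    · exact ih hn k hk
    · rwa [stopAt_succ_of_notMem hn] at h

theorem stopAt_notMem_of_forall {x : ℕ → X} {n : ℕ} (h : ∀ k ≤ n, x k ∉ Y) :
    stopAt Y x n ∉ Y := by
  induction n with
  | zero => exact h 0 le_rfl
  | succ n ih =>
    rw [stopAt_succ_of_notMem (ih fun k hk => h k (hk.trans n.le_succ))]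
    exact h _ le_rfl

theorem payoff_eq_stopAt {x : ℕ → X} {n : ℕ} (h : stopAt Y x n ∈ Y) :
    payoff Y F x = F ⟨stopAt Y x n, h⟩ := by
  classical
  induction n with
  | zero =>
    have hx : ∃ n, x n ∈ Y := ⟨0, h⟩
    have h0 : Nat.find hx = 0 := (Nat.find_eq_zero hx).2 h
    rw [payoff, dif_pos hx]
    congr 2
    rw [show stopAt Y x 0 = x 0 from rfl]
    convert! congrArg x h0
  | succ n ih =>
    by_cases hn : stopAt Y x n ∈ Y
    · rw [ih hn]
      congr 2
      rw [stopAt_succ_of_mem hn]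
    · have h' := h
      rw [stopAt_succ_of_notMem hn] at h'
      have hx : ∃ n, x n ∈ Y := ⟨_, h'⟩
      have h0 : Nat.find hx = n + 1 :=
        (Nat.find_eq_iff hx).2 ⟨h', fun k hk =>
          forall_notMem_of_stopAt_notMem hn k (Nat.lt_succ_iff.1 hk)⟩
      rw [payoff, dif_pos hx]
      congr 2
      rw [stopAt_succ_of_notMem hn]
      convert! congrArg x h0

theorem stopAt_congr {x x' : ℕ → X} {n : ℕ} (h : ∀ k ≤ n, x k = x' k) :
    stopAt Y x n = stopAt Y x' n := by
  induction n with
  | zero => exact h 0 le_rfl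
  | succ n ih =>
    rw [stopAt, stopAt, ih fun k hk => h k (hk.trans n.le_succ), h _ le_rfl]

theorem payoff_neg (x : ℕ → X) : payoff Y (fun y => -F y) x = -payoff Y F x := by
  unfold payoff
  split_ifs <;> simp

/-- If the expectation of `g` at the next position always exceeds the current value of `g` by `δ`,
then the game terminates and the expected payoff is at least the initial value of `g`. -/
theorem terminatesAS_and_le_integral {r : ℝ} (hr : 0 < r) {x : (ℕ → Bool) → ℕ → X} {x₀ : X}
    (hx₀ : ∀ ω, x ω 0 = x₀) (hx : ∀ n, DependsOn (fun ω => x ω n) (Set.Iio n))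
    {g : X → ℝ} (hgF : ∀ y : Y, g y = F y) {B : ℝ} (hB : ∀ x, |g x| ≤ B) {δ : ℝ} (hδ : 0 < δ)
    (hstep : ∀ ω n, x ω n ∉ Y → g (x ω n) + δ ≤
      r / (r + 1) * g (x (Function.update ω n true) (n + 1)) +
      (1 - r / (r + 1)) * g (x (Function.update ω n false) (n + 1))) :
    TerminatesAS Y r x ∧ g x₀ ≤ ∫ ω, payoff Y F (x ω) ∂(tosses r) := by
  classical
  set s : ℕ → (ℕ → Bool) → X := fun n ω => stopAt Y (x ω) n with hs
  have hsdep : ∀ n, DependsOn (s n) (Set.Iio n) := fun n ω ω' h =>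
    stopAt_congr fun k hk => hx k fun i hi => h i (lt_of_lt_of_le hi hk)
  have hgs : ∀ n, Measurable fun ω => g (s n ω) := fun n =>
    measurable_of_dependsOn (n := n) fun ω ω' h => by
      rw [hsdep n h]
  have hint : ∀ n, Integrable (fun ω => g (s n ω)) (tosses r) := fun n =>
    Integrable.of_bound (hgs n).aestronglyMeasurable B (.of_forall fun ω => hB _)
  set A : ℕ → Set (ℕ → Bool) := fun n => {ω | s n ω ∉ Y} with hA
  have hAm : ∀ n, MeasurableSet (A n) := fun n => by
    have : Measurable fun ω => decide (s n ω ∈ Y) :=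
      measurable_of_dependsOn (n := n) fun ω ω' h => by
        rw [hsdep n h]
    have h2 : A n = (fun ω => decide (s n ω ∈ Y)) ⁻¹' {false} := by ext ω; simp [hA]
    rw [h2]
    exact this (measurableSet_singleton _)
  have hAanti : Antitone A := antitone_nat_of_succ_le fun n ω h h' =>
    h (by change stopAt Y (x ω) (n + 1) ∈ Y; rwa [stopAt_succ_of_mem h'])
  -- Submartingale property with drift: a step gains `δ` on the event `A n` that the game is still
  -- running, and nothing changes elsewhere.
  have hone : ∀ n, ∫ ω, g (s n ω) ∂(tosses r) + δ * (tosses r).real (A n) ≤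
      ∫ ω, g (s (n + 1) ω) ∂(tosses r) := by
    intro n
    have hdep' : DependsOn (fun ω => g (s (n + 1) ω)) (Set.Iio (n + 1)) := fun ω ω' h => by
      change g (s (n + 1) ω) = g (s (n + 1) ω')
      rw [hsdep (n + 1) h]
    rw [integral_tosses_eq hr hdep' (fun ω => hB _) n]
    have h1 : δ * (tosses r).real (A n) = ∫ ω, (A n).indicator (fun _ => δ) ω ∂(tosses r) := by
      rw [integral_indicator (hAm n), setIntegral_const, smul_eq_mul, mul_comm]
    rw [h1, ← integral_add (hint n) ((integrable_const δ).indicator (hAm n))]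
    have hiu : ∀ c, Integrable (fun ω => g (s (n + 1) (Function.update ω n c))) (tosses r) :=
      fun c => Integrable.of_bound
        (measurable_of_dependsOn (DependsOn.update hdep' n c)).aestronglyMeasurable B
        (.of_forall fun ω => hB _)
    refine integral_mono ((hint n).add ((integrable_const δ).indicator (hAm n)))
      (((hiu true).const_mul _).add ((hiu false).const_mul _)) fun ω => ?_
    have hupd : ∀ c, ∀ k ≤ n, x (Function.update ω n c) k = x ω k := fun c k hk =>
      hx k fun i hi => Function.update_of_ne (lt_of_lt_of_le hi hk).ne _ _
    have hsn : ∀ c, stopAt Y (x (Function.update ω n c)) n = stopAt Y (x ω) n :=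
      fun c => stopAt_congr (hupd c)
    by_cases hmem : s n ω ∈ Y
    · have h2 : ∀ c, s (n + 1) (Function.update ω n c) = s n ω := fun c => by
        change stopAt Y (x (Function.update ω n c)) (n + 1) = _
        rw [stopAt_succ_of_mem (by rw [hsn]; exact hmem), hsn]
      have h3 : ω ∉ A n := fun h => h hmem
      simp only [h2, Set.indicator_of_notMem h3]
      linarith
    · have h2 : ∀ c, s (n + 1) (Function.update ω n c) = x (Function.update ω n c) (n + 1) :=
        fun c => stopAt_succ_of_notMem (by rw [hsn]; exact hmem)
      have h3 : ω ∈ A n := hmem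
      have h4 : s n ω = x ω n := stopAt_eq_of_notMem hmem
      simp only [h2, Set.indicator_of_mem h3]
      rw [h4]
      exact hstep ω n (h4 ▸ hmem)
  -- The events `A n` decrease, so each of the first `n` steps gains at least `δ` times the
  -- probability of `A n`. Since `g ≤ B`, the running game has probability `O(1 / n)`.
  have hsum : ∀ n : ℕ, g x₀ + δ * (n * (tosses r).real (A n)) ≤ ∫ ω, g (s n ω) ∂(tosses r) := by
    intro n
    induction n with
    | zero =>
      have : ∀ ω, s 0 ω = x₀ := fun ω => hx₀ ω
      simp [this]
    | succ n ih =>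
      refine le_trans ?_ (hone n)
      have h1 : (tosses r).real (A (n + 1)) ≤ (tosses r).real (A n) :=
        measureReal_mono (hAanti n.le_succ)
      have h2 : δ * (((n : ℝ) + 1) * (tosses r).real (A (n + 1))) ≤
          δ * (((n : ℝ) + 1) * (tosses r).real (A n)) := by gcongr
      push_cast
      linarith
  have hle : ∀ n, ∫ ω, g (s n ω) ∂(tosses r) ≤ B := fun n => by
    refine (integral_mono (hint n) (integrable_const B) fun ω => (abs_le.1 (hB _)).2).trans ?_
    simp
  have hterm : TerminatesAS Y r x := by
    have hsub : {ω | ¬ ∃ n, x ω n ∈ Y} ⊆ ⋂ n, A n := fun ω h => by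
      simp only [Set.mem_iInter]
      exact fun n => stopAt_notMem_of_forall fun k _ hk => h ⟨k, hk⟩
    refine measure_mono_null hsub ?_
    have hz : ∀ n : ℕ, δ * (n * (tosses r).real (⋂ n, A n)) ≤ B - g x₀ := fun n => by
      have h1 : (tosses r).real (⋂ n, A n) ≤ (tosses r).real (A n) :=
        measureReal_mono (Set.iInter_subset _ _)
      have h2 : δ * (n * (tosses r).real (⋂ n, A n)) ≤ δ * (n * (tosses r).real (A n)) := by
        gcongr
      linarith [hsum n, hle n]
    rw [← measureReal_eq_zero_iff]
    by_contra hne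
    have hpos : 0 < δ * (tosses r).real (⋂ n, A n) :=
      mul_pos hδ (lt_of_le_of_ne measureReal_nonneg (Ne.symm hne))
    obtain ⟨n, hn⟩ := exists_nat_gt ((B - g x₀) / (δ * (tosses r).real (⋂ n, A n)))
    rw [div_lt_iff₀ hpos] at hn
    linarith [hz n]
  refine ⟨hterm, ?_⟩
  have hlim : Filter.Tendsto (fun n => ∫ ω, g (s n ω) ∂(tosses r)) Filter.atTop
      (𝓝 (∫ ω, payoff Y F (x ω) ∂(tosses r))) := by
    refine tendsto_integral_of_dominated_convergence (fun _ => B)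
      (fun n => (hgs n).aestronglyMeasurable) (integrable_const B)
      (fun n => .of_forall fun ω => hB _) ?_
    filter_upwards [hterm] with ω hω
    obtain ⟨n, hn⟩ := hω
    refine tendsto_const_nhds.congr' ?_
    filter_upwards [Filter.eventually_ge_atTop n] with m hm
    have hmem : stopAt Y (x ω) m ∈ Y := by
      by_contra h
      exact forall_notMem_of_stopAt_notMem h n hm hn
    rw [payoff_eq_stopAt hmem]
    exact (hgF ⟨_, hmem⟩).symm
  refine ge_of_tendsto' hlim fun n => le_trans ?_ (hsum n)
  have : 0 ≤ δ * (n * (tosses r).real (A n)) := by positivity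
  linarith

/-- The mirror image of `terminatesAS_and_le_integral`. -/
theorem terminatesAS_and_integral_le {r : ℝ} (hr : 0 < r) {x : (ℕ → Bool) → ℕ → X} {x₀ : X}
    (hx₀ : ∀ ω, x ω 0 = x₀) (hx : ∀ n, DependsOn (fun ω => x ω n) (Set.Iio n))
    {g : X → ℝ} (hgF : ∀ y : Y, g y = F y) {B : ℝ} (hB : ∀ x, |g x| ≤ B) {δ : ℝ} (hδ : 0 < δ)
    (hstep : ∀ ω n, x ω n ∉ Y →
      r / (r + 1) * g (x (Function.update ω n true) (n + 1)) +
      (1 - r / (r + 1)) * g (x (Function.update ω n false) (n + 1)) + δ ≤ g (x ω n)) :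
    TerminatesAS Y r x ∧ ∫ ω, payoff Y F (x ω) ∂(tosses r) ≤ g x₀ := by
  have h := terminatesAS_and_le_integral (F := fun y => -F y) (g := fun x => -g x) hr hx₀ hx
    (fun y => by rw [hgF]) (B := B) (fun x => by rw [abs_neg]; exact hB x) hδ
    (fun ω n hn => by linarith [hstep ω n hn])
  refine ⟨h.1, ?_⟩
  have h2 := h.2
  simp only [payoff_neg, integral_neg] at h2
  linarith

end Payoff

/-! ### Sub- and supersolutions -/

section Solutions

variable {X : Type*} [MetricSpace X]

/-- The supremum of `f` over an open ball. -/
noncomputable def supBall (ε : ℝ) (f : X → ℝ) (x : X) : ℝ :=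
  ⨆ z : Metric.ball x ε, f z

/-- The infimum of `f` over an open ball. -/
noncomputable def infBall (ε : ℝ) (f : X → ℝ) (x : X) : ℝ :=
  -supBall ε (fun z => -f z) x

theorem le_supBall {ε B : ℝ} {f : X → ℝ} (hB : ∀ x, |f x| ≤ B) {x z : X} (hz : dist z x < ε) :
    f z ≤ supBall ε f x :=
  le_ciSup (f := fun z : Metric.ball x ε => f z)
    ⟨B, by rintro _ ⟨w, rfl⟩; exact (abs_le.1 (hB _)).2⟩ ⟨z, hz⟩

theorem supBall_le {ε : ℝ} (hε : 0 < ε) {f : X → ℝ} {x : X} {c : ℝ}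
    (h : ∀ z, dist z x < ε → f z ≤ c) : supBall ε f x ≤ c := by
  have : Nonempty (Metric.ball x ε) := ⟨⟨x, Metric.mem_ball_self hε⟩⟩
  exact ciSup_le fun z => h z z.2

theorem exists_lt_of_lt_supBall {ε : ℝ} (hε : 0 < ε) {f : X → ℝ} {x : X} {c : ℝ}
    (h : c < supBall ε f x) : ∃ z, dist z x < ε ∧ c < f z := by
  by_contra! hc
  exact absurd (supBall_le hε hc) (not_le.2 h)

theorem infBall_le {ε B : ℝ} {f : X → ℝ} (hB : ∀ x, |f x| ≤ B) {x z : X} (hz : dist z x < ε) :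
    infBall ε f x ≤ f z := by
  have := le_supBall (f := fun z => -f z) (B := B) (fun x => by rw [abs_neg]; exact hB x) hz
  unfold infBall
  linarith

theorem le_infBall {ε : ℝ} (hε : 0 < ε) {f : X → ℝ} {x : X} {c : ℝ}
    (h : ∀ z, dist z x < ε → c ≤ f z) : c ≤ infBall ε f x := by
  have := supBall_le (f := fun z => -f z) (x := x) (c := -c) hε fun z hz => by linarith [h z hz]
  unfold infBall
  linarith

theorem infBall_neg (ε : ℝ) (f : X → ℝ) (x : X) :
    infBall ε (fun z => -f z) x = -supBall ε f x := by
  simp [infBall]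

theorem supBall_neg (ε : ℝ) (f : X → ℝ) (x : X) :
    supBall ε (fun z => -f z) x = -infBall ε f x := by
  simp [infBall]

theorem supBall_mono {ε B : ℝ} (hε : 0 < ε) {f g : X → ℝ} (hB : ∀ x, |g x| ≤ B)
    (h : ∀ x, f x ≤ g x) (x : X) : supBall ε f x ≤ supBall ε g x :=
  supBall_le hε fun z hz => (h z).trans (le_supBall hB hz)

theorem infBall_mono {ε B : ℝ} (hε : 0 < ε) {f g : X → ℝ} (hB : ∀ x, |f x| ≤ B)
    (h : ∀ x, f x ≤ g x) (x : X) : infBall ε f x ≤ infBall ε g x :=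
  le_infBall hε fun z hz => (infBall_le hB hz).trans (h z)

/-- Off `Y`, the function `f` is exceeded by `δ` by its expectation after an optimally played step
of the ordinary game in which the maximizing player wins the toss with probability `p`. -/
def IsSub (Y : Set X) (ε p δ : ℝ) (f : X → ℝ) : Prop :=
  ∀ x, x ∉ Y → f x + δ ≤ p * supBall ε f x + (1 - p) * infBall ε f x

/-- Off `Y`, the function `f` exceeds by `δ` its expectation after an optimally played step
of the ordinary game in which the maximizing player wins the toss with probability `p`. -/
def IsSuper (Y : Set X) (ε p δ : ℝ) (f : X → ℝ) : Prop :=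
  ∀ x, x ∉ Y → p * supBall ε f x + (1 - p) * infBall ε f x + δ ≤ f x

/-- The analogue of `IsSub` for the favored game with a maximizing aimer who wins the toss with
probability `p`. -/
def IsFavSub (Y : Set X) (ε p δ : ℝ) (g : X → ℝ) : Prop :=
  ∀ x, x ∉ Y → ∃ z, dist z x < ε ∧ ∀ y y', ((dist y z < 2 * ε ∧ y ∈ Y) ∨ y = z) →
    dist y' z < 2 * ε → g x + δ ≤ p * g y + (1 - p) * g y'

variable {Y : Set X} {ε p : ℝ}

theorem IsSub.mono {δ δ' : ℝ} {f : X → ℝ} (h : IsSub Y ε p δ f) (hδ : δ' ≤ δ) :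
    IsSub Y ε p δ' f := fun x hx => by linarith [h x hx]

theorem IsSuper.mono {δ δ' : ℝ} {f : X → ℝ} (h : IsSuper Y ε p δ f) (hδ : δ' ≤ δ) :
    IsSuper Y ε p δ' f := fun x hx => by linarith [h x hx]

theorem IsSub.neg {δ : ℝ} {f : X → ℝ} (h : IsSub Y ε p δ f) :
    IsSuper Y ε (1 - p) δ fun x => -f x := fun x hx => by
  rw [supBall_neg, infBall_neg]
  linarith [h x hx]

theorem IsSuper.neg {δ : ℝ} {f : X → ℝ} (h : IsSuper Y ε p δ f) :
    IsSub Y ε (1 - p) δ fun x => -f x := fun x hx => by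
  rw [supBall_neg, infBall_neg]
  linarith [h x hx]

/-- The favored player may accept the target `z`, and the `ε`-ball around `x` lies in the `2 *
ε`-ball around `z`; so his options include those of the ordinary opponent. -/
theorem IsFavSub.isSub (hε : 0 < ε) (hp : 0 < p) (hp1 : p < 1) {δ B : ℝ} {g : X → ℝ}
    (hB : ∀ x, |g x| ≤ B) (h : IsFavSub Y ε p δ g) : IsSub Y ε p δ g := by
  intro x hx
  obtain ⟨z, hz, hzy⟩ := h x hx
  have h1 : p * g z ≤ p * supBall ε g x := by gcongr; exact le_supBall hB hz
  have h2 : (g x + δ - p * g z) / (1 - p) ≤ infBall ε g x := le_infBall hε fun y hy => by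
    rw [div_le_iff₀ (by linarith)]
    have := hzy z y (Or.inr rfl) (by linarith [dist_triangle_right y z x])
    linarith
  rw [div_le_iff₀ (by linarith)] at h2
  linarith

/-- The supremum over the open ball may not be attained; half of `δ` pays for an almost optimal
move. -/
theorem IsSub.exists_move (hε : 0 < ε) (hp : 0 < p) (hp1 : p < 1) {δ B : ℝ} (hδ : 0 < δ)
    {g : X → ℝ} (hB : ∀ x, |g x| ≤ B) (h : IsSub Y ε p δ g) {x : X} (hx : x ∉ Y) :
    ∃ z, dist z x < ε ∧ ∀ y, dist y x < ε → g x + δ / 2 ≤ p * g z + (1 - p) * g y := by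
  have h1 : supBall ε g x - δ / 2 < supBall ε g x := by linarith
  obtain ⟨z, hz, hgz⟩ := exists_lt_of_lt_supBall hε h1
  refine ⟨z, hz, fun y hy => ?_⟩
  have h2 : (1 - p) * infBall ε g x ≤ (1 - p) * g y :=
    mul_le_mul_of_nonneg_left (infBall_le hB hy) (by linarith)
  have h3 : p * (supBall ε g x - δ / 2) ≤ p * g z := by gcongr
  have h4 : p * (δ / 2) ≤ δ / 2 := by nlinarith
  linarith [h x hx]

/-! ### Comparison -/

/-- With `φ t = t + θ * t ^ 2`, increasing and 2-Lipschitz on `[-B, B]`, convexity gives `φ ∘ f` an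
extra gain proportional to the squared oscillation of `f`. At an almost maximum of `φ ∘ f - g` there
is no room for this gain, so the oscillation is small. There is also little slack in the bound of `φ
(supBall ε f x)` by `supBall ε g x + M`, which bounds `g` from above on the whole ball. -/
theorem le_of_quadratic_gain {θ B δ η M : ℝ} (hε : 0 < ε) (hp : 0 < p) (hp1 : p < 1) (hθ : 0 < θ)
    (hθB : 2 * θ * B ≤ 1 / 2) {f g : X → ℝ} (hf : ∀ x, |f x| ≤ B) (hg : ∀ x, |g x| ≤ B)
    (hfs : IsSub Y ε p 0 f) (hgs : IsSuper Y ε p (-δ) g)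
    (hM : ∀ x, f x + θ * f x ^ 2 - g x ≤ M) {x : X} (hx : x ∉ Y)
    (hxM : M - η ≤ f x + θ * f x ^ 2 - g x) :
    θ * p * (1 - p) * (supBall ε f x - infBall ε f x) ^ 2 ≤ η + δ ∧
      ∀ z, dist z x < ε →
        M - 2 * (supBall ε f x - infBall ε f x) - (η + δ) / p ≤ f z + θ * f z ^ 2 - g z := by
  set a := supBall ε f x
  set b := infBall ε f x
  have hxx : dist x x < ε := by simpa using hε
  have haB : a ≤ B := supBall_le hε fun z _ => (abs_le.1 (hf z)).2
  have hbB : -B ≤ b := le_infBall hε fun z _ => (abs_le.1 (hf z)).1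
  have hxa : f x ≤ a := le_supBall hf hxx
  have hbx : b ≤ f x := infBall_le hf hxx
  have hfx := abs_le.1 (hf x)
  have hmono : ∀ s t, -B ≤ s → s ≤ t → t ≤ B → s + θ * s ^ 2 ≤ t + θ * t ^ 2 := by
    intro s t hs hst ht
    have : 0 ≤ (t - s) * (1 + θ * (s + t)) := by
      refine mul_nonneg (by linarith) ?_
      have : θ * (-(2 * B)) ≤ θ * (s + t) := by
        refine mul_le_mul_of_nonneg_left ?_ hθ.le
        linarith
      linarith
    nlinarith
  have hlip : a + θ * a ^ 2 - (b + θ * b ^ 2) ≤ 2 * (a - b) := by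
    have h1 : θ * (a + b) ≤ θ * (2 * B) := by
      refine mul_le_mul_of_nonneg_left ?_ hθ.le
      linarith
    have h2 : (a - b) * (θ * (a + b)) ≤ (a - b) * 1 :=
      mul_le_mul_of_nonneg_left (by linarith) (by linarith)
    nlinarith
  have hsup : a + θ * a ^ 2 ≤ supBall ε g x + M := by
    refine le_of_forall_pos_le_add fun κ hκ => ?_
    obtain ⟨z, hz, haz⟩ := exists_lt_of_lt_supBall (f := f) (x := x) (c := a - κ / 2) hε
      (by change a - κ / 2 < a; linarith)
    have hza : f z ≤ a := le_supBall hf hz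
    have h1 : θ * (a + f z) ≤ θ * (2 * B) := by
      refine mul_le_mul_of_nonneg_left ?_ hθ.le
      linarith
    have h2 : (a - f z) * (θ * (a + f z)) ≤ (a - f z) * 1 :=
      mul_le_mul_of_nonneg_left (by linarith) (by linarith)
    have h3 := hM z
    have h4 : g z ≤ supBall ε g x := le_supBall hg hz
    nlinarith
  have hinf : b + θ * b ^ 2 ≤ infBall ε g x + M := by
    have : b + θ * b ^ 2 - M ≤ infBall ε g x := le_infBall hε fun z hz => by
      have := hmono b (f z) hbB (infBall_le hf hz) (abs_le.1 (hf z)).2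
      linarith [hM z]
    linarith
  have hfx' : f x + θ * f x ^ 2 ≤
      p * (a + θ * a ^ 2) + (1 - p) * (b + θ * b ^ 2) - θ * p * (1 - p) * (a - b) ^ 2 := by
    have h1 := hfs x hx
    have h2 := hmono (f x) (p * a + (1 - p) * b) hfx.1 (by linarith) (by nlinarith)
    refine h2.trans (le_of_eq ?_)
    ring
  have hgx := hgs x hx
  have h5 : p * (a + θ * a ^ 2) ≤ p * (supBall ε g x + M) := by gcongr
  have h6 : (1 - p) * (b + θ * b ^ 2) ≤ (1 - p) * (infBall ε g x + M) :=
    mul_le_mul_of_nonneg_left hinf (by linarith)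
  have hgain : 0 ≤ θ * p * (1 - p) * (a - b) ^ 2 := by
    have : 0 < 1 - p := by linarith
    positivity
  refine ⟨by linarith, fun z hz => ?_⟩
  have h7 : p * (supBall ε g x + M - (a + θ * a ^ 2)) ≤ η + δ := by linarith
  have h8 : supBall ε g x + M - (a + θ * a ^ 2) ≤ (η + δ) / p := by
    rw [le_div_iff₀ hp]; linarith
  have h9 : g z ≤ supBall ε g x := le_supBall hg hz
  have h10 := hmono b (f z) hbB (infBall_le hf hz) (abs_le.1 (hf z)).2
  linarith

/-- Near a point where `f + θ f² - g` is almost maximal, it is almost maximal. -/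
theorem exists_almost_max_propagates {θ B κ : ℝ} (hε : 0 < ε) (hp : 0 < p) (hp1 : p < 1)
    (hθ : 0 < θ) (hθB : 2 * θ * B ≤ 1 / 2) {f : X → ℝ} (hf : ∀ x, |f x| ≤ B)
    (hfs : IsSub Y ε p 0 f) (hκ : 0 < κ) :
    ∃ η > 0, ∀ δ ≤ η, ∀ (g : X → ℝ) (M : ℝ), (∀ x, |g x| ≤ B) → IsSuper Y ε p (-δ) g →
      (∀ x, f x + θ * f x ^ 2 - g x ≤ M) → ∀ x ∉ Y, M - η ≤ f x + θ * f x ^ 2 - g x →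
        ∀ z, dist z x < ε → M - κ ≤ f z + θ * f z ^ 2 - g z := by
  have hq : 0 < 1 - p := by linarith
  -- Chosen so that `η + δ` forces an oscillation of at most `κ / 4`, counted twice, and an error
  -- `(η + δ) / p` of at most `κ / 2`.
  refine ⟨min (θ * p * (1 - p) * (κ / 4) ^ 2) (p * (κ / 2)) / 2, by positivity, ?_⟩
  intro δ hδ g M hg hgs hM x hx hxM z hz
  obtain ⟨h1, h2⟩ := le_of_quadratic_gain hε hp hp1 hθ hθB hf hg hfs hgs hM hx hxM
  have h3 := h2 z hz
  set m := min (θ * p * (1 - p) * (κ / 4) ^ 2) (p * (κ / 2)) with hm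
  have h4 : m / 2 + δ ≤ m := by linarith
  have h5 : supBall ε f x - infBall ε f x ≤ κ / 4 := by
    refine le_of_sq_le_sq ?_ (by positivity)
    refine le_of_mul_le_mul_left ((h1.trans h4).trans (min_le_left _ _)) (by positivity)
  have h6 : (m / 2 + δ) / p ≤ κ / 2 := by
    rw [div_le_iff₀ hp]
    linarith [min_le_right (θ * p * (1 - p) * (κ / 4) ^ 2) (p * (κ / 2))]
  linarith

/-- A subsolution is bounded by approximate supersolutions that bound it on `Y`. -/
theorem IsSub.le_add_of_isSuper (hX : IsLengthSpace X) {D : ℝ} (hD : ∀ x y : X, dist x y ≤ D)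
    (hYne : Y.Nonempty) (hε : 0 < ε) (hp : 0 < p) (hp1 : p < 1) {f : X → ℝ} {B : ℝ}
    (hf : ∀ x, |f x| ≤ B) (hfs : IsSub Y ε p 0 f) {η : ℝ} (hη : 0 < η) :
    ∃ δ₀ > 0, ∀ δ ≤ δ₀, ∀ g : X → ℝ, (∀ x, |g x| ≤ B) → IsSuper Y ε p (-δ) g →
      (∀ y ∈ Y, f y ≤ g y) → ∀ x, f x ≤ g x + η := by
  obtain ⟨y₀, hy₀⟩ := hYne
  have hB : 0 ≤ B := (abs_nonneg _).trans (hf y₀)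
  obtain ⟨θ, hθ, hθB, hθη⟩ : ∃ θ > 0, 2 * θ * B ≤ 1 / 2 ∧ θ * B ^ 2 ≤ η / 2 := by
    refine ⟨min (1 / (4 * (B + 1))) (η / (2 * (B ^ 2 + 1))), by positivity, ?_, ?_⟩
    · have h1 := min_le_left (1 / (4 * (B + 1))) (η / (2 * (B ^ 2 + 1)))
      rw [le_div_iff₀ (by positivity)] at h1
      have : 0 < min (1 / (4 * (B + 1))) (η / (2 * (B ^ 2 + 1))) := by positivity
      linarith
    · have h1 := min_le_right (1 / (4 * (B + 1))) (η / (2 * (B ^ 2 + 1)))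
      rw [le_div_iff₀ (by positivity)] at h1
      have : 0 < min (1 / (4 * (B + 1))) (η / (2 * (B ^ 2 + 1))) := by positivity
      linarith
  -- Walk from an almost maximum towards `y₀` in steps shorter than `ε`, stopping early on meeting
  -- `Y`. The tolerance does not depend on `g`, which matters because `g` will later vary with `δ`.
  have hchain : ∀ n : ℕ, ∀ κ > 0, ∃ δ₀ > 0, ∀ δ ≤ δ₀, ∀ (g : X → ℝ) (M : ℝ), (∀ x, |g x| ≤ B) →
      IsSuper Y ε p (-δ) g → (∀ x, f x + θ * f x ^ 2 - g x ≤ M) →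
      ∀ x, dist x y₀ < (n + 1) * ε → M - δ₀ ≤ f x + θ * f x ^ 2 - g x →
        ∃ y ∈ Y, M - κ ≤ f y + θ * f y ^ 2 - g y := by
    intro n
    induction n with
    | zero =>
      intro κ hκ
      obtain ⟨δ₁, hδ₁, h1⟩ := exists_almost_max_propagates hε hp hp1 hθ hθB hf hfs hκ
      refine ⟨min δ₁ κ, lt_min hδ₁ hκ, fun δ hδ g M hg hgs hM x hxy hxM => ?_⟩
      by_cases hx : x ∈ Y
      · exact ⟨x, hx, by linarith [min_le_right δ₁ κ]⟩
      · refine ⟨y₀, hy₀, h1 δ (hδ.trans (min_le_left _ _)) g M hg hgs hM x hx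
          (by linarith [min_le_left δ₁ κ]) y₀ ?_⟩
        rw [dist_comm]
        simpa using hxy
    | succ n ih =>
      intro κ hκ
      obtain ⟨δ₂, hδ₂, h2⟩ := ih κ hκ
      obtain ⟨δ₁, hδ₁, h1⟩ := exists_almost_max_propagates hε hp hp1 hθ hθB hf hfs hδ₂
      refine ⟨min (min δ₁ δ₂) κ, lt_min (lt_min hδ₁ hδ₂) hκ,
        fun δ hδ g M hg hgs hM x hxy hxM => ?_⟩
      have h3 := min_le_left (min δ₁ δ₂) κ
      have h4 := min_le_right (min δ₁ δ₂) κ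
      have h5 := min_le_left δ₁ δ₂
      have h6 := min_le_right δ₁ δ₂
      by_cases hx : x ∈ Y
      · exact ⟨x, hx, by linarith⟩
      · obtain ⟨z, hzx, hzy⟩ := hX.exists_between (x := x) (y := y₀) hε
          (b := (n + 1) * ε) (by positivity) (by push_cast at hxy; linarith)
        exact h2 δ (by linarith) g M hg hgs hM z hzy
          (h1 δ (by linarith) g M hg hgs hM x hx (by linarith) z hzx)
  obtain ⟨N, hN⟩ := exists_nat_gt (D / ε)
  have hND : D < (N + 1) * ε := by
    rw [div_lt_iff₀ hε] at hN
    linarith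
  -- One half of `η` goes to the chain, the other to the perturbation `θ * f ^ 2` at the boundary
  -- point reached.
  obtain ⟨δ₀, hδ₀, h⟩ := hchain N (η / 2) (by positivity)
  refine ⟨δ₀, hδ₀, fun δ hδ g hg hgs hfg x => ?_⟩
  have hsq : ∀ x, θ * f x ^ 2 ≤ θ * B ^ 2 := fun x => by
    have := sq_le_sq' (abs_le.1 (hf x)).1 (abs_le.1 (hf x)).2
    gcongr
  have hbdd : BddAbove (Set.range fun x => f x + θ * f x ^ 2 - g x) := by
    refine ⟨B + θ * B ^ 2 + B, ?_⟩
    rintro _ ⟨x, rfl⟩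
    have := (abs_le.1 (hf x)).2
    have := (abs_le.1 (hg x)).1
    have := hsq x
    change f x + θ * f x ^ 2 - g x ≤ _
    linarith
  have : Nonempty X := ⟨y₀⟩
  have hM := le_ciSup hbdd
  obtain ⟨x₁, hx₁⟩ := exists_lt_of_lt_ciSup
    (show (⨆ x, (f x + θ * f x ^ 2 - g x)) - δ₀ < ⨆ x, (f x + θ * f x ^ 2 - g x) by linarith)
  obtain ⟨y, hy, hyM⟩ := h δ hδ g _ hg hgs hM x₁ ((hD _ _).trans_lt hND) hx₁.le
  have h1 := hM x
  have h2 := hfg y hy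
  have h3 := hsq y
  have h4 : 0 ≤ θ * f x ^ 2 := by positivity
  linarith

theorem IsSub.le_of_isSuper (hX : IsLengthSpace X) {D : ℝ} (hD : ∀ x y : X, dist x y ≤ D)
    (hYne : Y.Nonempty) (hε : 0 < ε) (hp : 0 < p) (hp1 : p < 1) {f g : X → ℝ} {B B' : ℝ}
    (hf : ∀ x, |f x| ≤ B) (hg : ∀ x, |g x| ≤ B') (hfs : IsSub Y ε p 0 f)
    (hgs : IsSuper Y ε p 0 g) (hfg : ∀ y ∈ Y, f y ≤ g y) (x : X) : f x ≤ g x := by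
  refine le_of_forall_pos_le_add fun η hη => ?_
  obtain ⟨δ₀, hδ₀, h⟩ := hfs.le_add_of_isSuper hX hD hYne hε hp hp1 (B := max B B')
    (fun x => (hf x).trans (le_max_left _ _)) hη
  exact h 0 hδ₀.le g (fun x => (hg x).trans (le_max_right _ _)) (by simpa using hgs) hfg x

/-! ### Existence of solutions -/

/-- Between a subsolution and a supersolution with the same boundary values there is a solution. -/
theorem exists_solution (hε : 0 < ε) (hp : 0 < p) (hp1 : p < 1) {δ B : ℝ} {L U : X → ℝ}
    (hLB : ∀ x, |L x| ≤ B) (hUB : ∀ x, |U x| ≤ B) (hLU : ∀ x, L x ≤ U x)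
    (hYLU : ∀ y ∈ Y, L y = U y) (hL : IsSub Y ε p δ L) (hU : IsSuper Y ε p (-δ) U) :
    ∃ u : X → ℝ, (∀ x, |u x| ≤ B) ∧ (∀ y ∈ Y, u y = U y) ∧ IsSub Y ε p δ u ∧
      IsSuper Y ε p (-δ) u := by
  classical
  set S : Set (X → ℝ) := {f | (∀ x, L x ≤ f x) ∧ (∀ x, f x ≤ U x) ∧ IsSub Y ε p δ f}
  have hLS : L ∈ S := ⟨fun _ => le_rfl, hLU, hL⟩
  have : Nonempty S := ⟨⟨L, hLS⟩⟩
  have hbet : ∀ f : X → ℝ, (∀ x, L x ≤ f x) → (∀ x, f x ≤ U x) → ∀ x, |f x| ≤ B :=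
    fun f h1 h2 x => abs_le.2 ⟨(abs_le.1 (hLB x)).1.trans (h1 x),
      (h2 x).trans (abs_le.1 (hUB x)).2⟩
  set u : X → ℝ := fun x => ⨆ f : S, f.1 x with hu
  have hle : ∀ f ∈ S, ∀ x, f x ≤ u x := fun f hf x =>
    le_ciSup (f := fun f : S => f.1 x) ⟨U x, by rintro _ ⟨f, rfl⟩; exact f.2.2.1 x⟩ ⟨f, hf⟩
  have huU : ∀ x, u x ≤ U x := fun x => ciSup_le fun f => f.2.2.1 x
  have hLu : ∀ x, L x ≤ u x := hle L hLS
  have huB := hbet u hLu huU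
  have hq : 0 ≤ 1 - p := by linarith
  have hTmono : ∀ f g : X → ℝ, (∀ x, |f x| ≤ B) → (∀ x, |g x| ≤ B) → (∀ x, f x ≤ g x) →
      ∀ x, p * supBall ε f x + (1 - p) * infBall ε f x ≤
        p * supBall ε g x + (1 - p) * infBall ε g x := fun f g hf hg h x =>
    add_le_add (mul_le_mul_of_nonneg_left (supBall_mono hε hg h x) hp.le)
      (mul_le_mul_of_nonneg_left (infBall_mono hε hf h x) hq)
  have husub : IsSub Y ε p δ u := by
    intro x hx
    have : u x ≤ p * supBall ε u x + (1 - p) * infBall ε u x - δ := ciSup_le fun f => by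
      have h1 := f.2.2.2 x hx
      have h2 := hTmono f u (hbet f f.2.1 f.2.2.1) huB (hle f f.2) x
      linarith
    linarith
  -- One application of the dynamic programming operator to the largest subsolution `u` gives a
  -- competitor `T ≥ u`, so maximality forces `T ≤ u`, the supersolution property.
  set T : X → ℝ := fun x =>
    if x ∈ Y then U x else p * supBall ε u x + (1 - p) * infBall ε u x - δ with hT
  have hTY : ∀ x ∈ Y, T x = U x := fun x hx => if_pos hx
  have hTnY : ∀ x ∉ Y, T x = p * supBall ε u x + (1 - p) * infBall ε u x - δ :=
    fun x hx => if_neg hx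
  have huT : ∀ x, u x ≤ T x := fun x => by
    by_cases hx : x ∈ Y
    · rw [hTY x hx]; exact huU x
    · rw [hTnY x hx]; linarith [husub x hx]
  have hTU : ∀ x, T x ≤ U x := fun x => by
    by_cases hx : x ∈ Y
    · rw [hTY x hx]
    · rw [hTnY x hx]
      have h1 := hTmono u U huB hUB huU x
      have h2 := hU x hx
      linarith
  have hTB := hbet T (fun x => (hLu x).trans (huT x)) hTU
  have hTS : T ∈ S := ⟨fun x => (hLu x).trans (huT x), hTU, fun x hx => by
    rw [hTnY x hx]
    linarith [hTmono u T huB hTB huT x]⟩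
  refine ⟨u, huB, fun y hy => le_antisymm (huU y) ((hYLU y hy).symm.le.trans (hLu y)), husub,
    fun x hx => ?_⟩
  have := hle T hTS x
  rw [hTnY x hx] at this
  linarith

end Solutions

/-! ### Barriers -/

/-- A concave function that grows at least like `K t` on `[0, D]`. -/
noncomputable def cone (K Λ D t : ℝ) : ℝ :=
  K * Real.exp (Λ * D) / Λ * (1 - Real.exp (-(Λ * t)))

section Cone

variable {K Λ D : ℝ}

theorem cone_mono (hK : 0 < K) (hΛ : 0 < Λ) {s t : ℝ} (h : s ≤ t) :
    cone K Λ D s ≤ cone K Λ D t := by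
  unfold cone
  gcongr

/-- The slope at `t` is `K * exp (Λ * (D - t))`, at least `K` up to `D`; this is the purpose of the
factor `exp (Λ * D)`. -/
theorem le_cone (hK : 0 < K) (hΛ : 0 < Λ) {t : ℝ} (h0 : 0 ≤ t) (h : t ≤ D) :
    K * t ≤ cone K Λ D t := by
  have h1 : Λ * t * Real.exp (-(Λ * t)) ≤ 1 - Real.exp (-(Λ * t)) := by
    have h2 := Real.add_one_le_exp (Λ * t)
    have h3 : (Λ * t + 1) * Real.exp (-(Λ * t)) ≤ Real.exp (Λ * t) * Real.exp (-(Λ * t)) := by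
      gcongr
    rw [← Real.exp_add, add_neg_cancel, Real.exp_zero] at h3
    linarith
  have h4 : 1 ≤ Real.exp (Λ * D) * Real.exp (-(Λ * t)) := by
    rw [← Real.exp_add]
    exact Real.one_le_exp (by nlinarith)
  calc K * t = K * t * 1 := by ring
    _ ≤ K * t * (Real.exp (Λ * D) * Real.exp (-(Λ * t))) := by gcongr
    _ = K * Real.exp (Λ * D) / Λ * (Λ * t * Real.exp (-(Λ * t))) := by field_simp
    _ ≤ cone K Λ D t := by unfold cone; gcongr

theorem cone_nonneg (hK : 0 < K) (hΛ : 0 < Λ) {t : ℝ} (h0 : 0 ≤ t) : 0 ≤ cone K Λ D t := by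
  have : Real.exp (-(Λ * t)) ≤ 1 := Real.exp_le_one_iff.2 (by nlinarith)
  unfold cone
  exact mul_nonneg (by positivity) (by linarith)

theorem cone_le (hK : 0 < K) (hΛ : 0 < Λ) (t : ℝ) :
    cone K Λ D t ≤ K * Real.exp (Λ * D) * t := by
  have h := Real.add_one_le_exp (-(Λ * t))
  calc cone K Λ D t ≤ K * Real.exp (Λ * D) / Λ * (Λ * t) := by
        unfold cone
        gcongr
        linarith
    _ = K * Real.exp (Λ * D) * t := by field_simp

theorem cone_le_const (hK : 0 < K) (hΛ : 0 < Λ) (t : ℝ) :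
    cone K Λ D t ≤ K * Real.exp (Λ * D) / Λ := by
  have h := Real.exp_pos (-(Λ * t))
  unfold cone
  exact mul_le_of_le_one_right (by positivity) (by linarith)

/-- If the odds against the minimizing player are less than `exp (Λ ε)` to `1`, then `cone`
is a strict supersolution. -/
theorem exists_cone_strict {ε p : ℝ} (hK : 0 < K) (hΛ : 0 < Λ) (hε : 0 < ε)
    (hodds : 1 - p < p * Real.exp (Λ * ε)) :
    ∃ τ > 0, τ ≤ ε ∧ ∃ δ > 0, ∀ d ≤ D,
      p * cone K Λ D (d - ε + τ) + (1 - p) * cone K Λ D (d + ε + τ) + δ ≤ cone K Λ D d := by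
  set s := Real.exp (Λ * ε) with hs
  have hs1 : 1 < s := Real.one_lt_exp_iff.2 (by positivity)
  set m := p * s + (1 - p) * s⁻¹ - 1 with hm
  have hmpos : 0 < m := by
    have : m = (s - 1) * (p * s - (1 - p)) / s := by
      rw [hm]; field_simp; ring
    rw [this]
    exact div_pos (mul_pos (by linarith) (by linarith)) (by linarith)
  set A := K * Real.exp (Λ * D) / Λ with hA
  have hApos : 0 < A := by positivity
  -- Slack for open balls, where the distance can only be lowered to less than `d - ε + τ`; it uses
  -- up at most half of the growth `m`.
  set τ := min ε (m / (2 * Λ * (1 + m))) with hτ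
  have hτpos : 0 < τ := by positivity
  have hτm : Λ * τ * (1 + m) ≤ m / 2 := by
    have h1 : τ ≤ m / (2 * Λ * (1 + m)) := min_le_right _ _
    rw [le_div_iff₀ (by positivity)] at h1
    linarith
  refine ⟨τ, hτpos, min_le_left _ _, A * Real.exp (-(Λ * D)) * (m / 2), by positivity,
    fun d hd => ?_⟩
  have h1 : m / 2 ≤ Real.exp (-(Λ * τ)) * (1 + m) - 1 := by
    have h2 := Real.add_one_le_exp (-(Λ * τ))
    have h3 : (-(Λ * τ) + 1) * (1 + m) ≤ Real.exp (-(Λ * τ)) * (1 + m) := by gcongr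
    linarith
  have h4 : A * Real.exp (-(Λ * D)) * (m / 2) ≤ A * Real.exp (-(Λ * d)) * (m / 2) := by
    gcongr
  have h5 : A * Real.exp (-(Λ * d)) * (m / 2) ≤
      A * Real.exp (-(Λ * d)) * (Real.exp (-(Λ * τ)) * (1 + m) - 1) := by gcongr
  have e1 : Real.exp (-(Λ * (d - ε + τ))) = Real.exp (-(Λ * d)) * Real.exp (-(Λ * τ)) * s := by
    rw [hs, ← Real.exp_add, ← Real.exp_add]; congr 1; ring
  have e2 : Real.exp (-(Λ * (d + ε + τ))) = Real.exp (-(Λ * d)) * Real.exp (-(Λ * τ)) * s⁻¹ := by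
    rw [hs, ← Real.exp_neg, ← Real.exp_add, ← Real.exp_add]; congr 1; ring
  unfold cone
  rw [← hA, e1, e2]
  have h6 : 1 + m = p * s + (1 - p) * s⁻¹ := by rw [hm]; ring
  rw [h6] at h5
  linarith

end Cone

section Barrier

variable {X : Type*} [MetricSpace X]

open Classical in
/-- A lower barrier at `y` with boundary values `Φ`. -/
noncomputable def barrier (Y : Set X) (Φ : X → ℝ) (K Λ D ε : ℝ) (y x : X) : ℝ :=
  if x ∈ Y then Φ x else Φ y - 12 * (K * Real.exp (Λ * D)) * ε - cone K Λ D (dist x y)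

variable {Y : Set X} {Φ : X → ℝ} {K Λ D ε p : ℝ}

theorem barrier_of_mem {x y : X} (hx : x ∈ Y) : barrier Y Φ K Λ D ε y x = Φ x := if_pos hx

theorem barrier_of_notMem {x y : X} (hx : x ∉ Y) : barrier Y Φ K Λ D ε y x =
    Φ y - 12 * (K * Real.exp (Λ * D)) * ε - cone K Λ D (dist x y) := if_neg hx

/-- On `Y` this is the Lipschitz bound, since the cone dominates `K * dist x y`. -/
theorem barrier_ge (hK : 0 < K) (hΛ : 0 < Λ) (hD : ∀ x y : X, dist x y ≤ D) (hε : 0 < ε)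
    (hΦ : ∀ y ∈ Y, ∀ y' ∈ Y, |Φ y - Φ y'| ≤ K * dist y y') {y : X} (hy : y ∈ Y) (x : X) :
    Φ y - 12 * (K * Real.exp (Λ * D)) * ε - cone K Λ D (dist x y) ≤ barrier Y Φ K Λ D ε y x := by
  by_cases hx : x ∈ Y
  · rw [barrier_of_mem hx]
    have h1 := (abs_le.1 (hΦ x hx y hy)).1
    have h2 := le_cone hK hΛ dist_nonneg (hD x y)
    have : 0 < 12 * (K * Real.exp (Λ * D)) * ε := by positivity
    linarith
  · rw [barrier_of_notMem hx]

theorem abs_barrier_le (hK : 0 < K) (hΛ : 0 < Λ) (hε : 0 < ε) {BΦ : ℝ}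
    (hBΦ : ∀ y ∈ Y, |Φ y| ≤ BΦ) {y : X} (hy : y ∈ Y) (x : X) :
    |barrier Y Φ K Λ D ε y x| ≤
      BΦ + 12 * (K * Real.exp (Λ * D)) * ε + K * Real.exp (Λ * D) / Λ := by
  have h1 : 0 < 12 * (K * Real.exp (Λ * D)) * ε := by positivity
  have h2 : 0 < K * Real.exp (Λ * D) / Λ := by positivity
  by_cases hx : x ∈ Y
  · rw [barrier_of_mem hx]
    linarith [hBΦ x hx]
  · rw [barrier_of_notMem hx, abs_le]
    have h3 := abs_le.1 (hBΦ y hy)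
    have h4 := cone_nonneg (D := D) hK hΛ (dist_nonneg (x := x) (y := y))
    have h5 := cone_le_const (D := D) hK hΛ (dist x y)
    constructor <;> linarith

/-- Aim towards `y₀`: far away the concave cone gives the gain, and within `ε` one aims at `y₀`
itself, where the barrier jumps up by `12 * L * ε`. That jump also absorbs an early stop by the
favored player elsewhere in `Y`. -/
theorem exists_isFavSub_barrier (hX : IsLengthSpace X) (hK : 0 < K) (hΛ : 0 < Λ)
    (hD : ∀ x y : X, dist x y ≤ D) (hε : 0 < ε) (hp : 1 / 4 ≤ p) (hp1 : p < 1)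
    (hodds : 1 - p < p * Real.exp (Λ * ε))
    (hΦ : ∀ y ∈ Y, ∀ y' ∈ Y, |Φ y - Φ y'| ≤ K * dist y y') :
    ∃ δ > 0, ∀ y ∈ Y, IsFavSub Y ε p δ (barrier Y Φ K Λ D ε y) := by
  obtain ⟨τ, hτ, hτε, δ, hδ, hcone⟩ := exists_cone_strict (D := D) hK hΛ hε hodds
  set L := K * Real.exp (Λ * D) with hL
  have hLpos : 0 < L := by positivity
  have hq : 0 < 1 - p := by linarith
  refine ⟨min δ (L * ε), by positivity, fun y₀ hy₀ x hx => ?_⟩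
  have hKL : K ≤ L := by
    have hD0 : 0 ≤ D := dist_nonneg.trans (hD x x)
    exact le_mul_of_one_le_right hK.le (Real.one_le_exp (by positivity))
  have hge := fun z => barrier_ge (D := D) hK hΛ hD hε hΦ hy₀ z
  rw [barrier_of_notMem hx]
  rw [← hL] at hge ⊢
  by_cases hd : dist x y₀ < ε
  · refine ⟨y₀, by rwa [dist_comm], fun y y' hy hy' => ?_⟩
    have h1 : Φ y₀ - 2 * L * ε ≤ barrier Y Φ K Λ D ε y₀ y := by
      rcases hy with ⟨hy, hyY⟩ | rfl
      · rw [barrier_of_mem hyY]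
        have h2 := (abs_le.1 (hΦ y hyY y₀ hy₀)).1
        have h3 : K * dist y y₀ ≤ L * (2 * ε) := by gcongr
        linarith
      · rw [barrier_of_mem hy₀]
        have : 0 < L * ε := by positivity
        linarith
    have h2 : Φ y₀ - 14 * L * ε ≤ barrier Y Φ K Λ D ε y₀ y' := by
      have h3 := hge y'
      have h4 := cone_le (D := D) hK hΛ (dist y' y₀)
      have h5 : L * dist y' y₀ ≤ L * (2 * ε) := by gcongr
      linarith
    have h3 : p * (Φ y₀ - 2 * L * ε) ≤ p * barrier Y Φ K Λ D ε y₀ y := by gcongr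
    have h4 : (1 - p) * (Φ y₀ - 14 * L * ε) ≤ (1 - p) * barrier Y Φ K Λ D ε y₀ y' := by gcongr
    have h5 := cone_nonneg (D := D) hK hΛ (dist_nonneg (x := x) (y := y₀))
    -- The average loss is `2 * p + 14 * (1 - p) = 14 - 12 * p ≤ 11` in units of `L * ε`, against 12
    -- in the barrier; the spare unit bounds the gain.
    have h6 : 1 / 4 * (L * ε) ≤ p * (L * ε) := by gcongr
    have h7 := min_le_right δ (L * ε)
    linarith
  · obtain ⟨z, hzx, hzy⟩ := hX.exists_between (x := x) (y := y₀) hε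
      (b := dist x y₀ - ε + τ) (by linarith) (by linarith)
    refine ⟨z, hzx, fun y y' hy hy' => ?_⟩
    have hd' : dist x y₀ ≤ D := hD x y₀
    have h1 : Φ y₀ - 12 * L * ε - cone K Λ D (dist x y₀ - ε + τ) ≤
        barrier Y Φ K Λ D ε y₀ y := by
      rcases hy with ⟨hy, hyY⟩ | rfl
      · rw [barrier_of_mem hyY]
        have h2 := (abs_le.1 (hΦ y hyY y₀ hy₀)).1
        have h3 : K * dist y y₀ ≤ K * (dist x y₀ - ε + τ) + K * (2 * ε) := by
          rw [← mul_add]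
          gcongr
          linarith [dist_triangle y z y₀]
        have h4 := le_cone (D := D) hK hΛ (t := dist x y₀ - ε + τ) (by linarith) (by linarith)
        have h5 : K * (2 * ε) ≤ L * (2 * ε) := by gcongr
        have : 0 < L * ε := by positivity
        linarith
      · exact le_trans (by linarith [cone_mono (D := D) hK hΛ hzy.le]) (hge y)
    have h2 : Φ y₀ - 12 * L * ε - cone K Λ D (dist x y₀ + ε + τ) ≤
        barrier Y Φ K Λ D ε y₀ y' := by
      have h3 : dist y' y₀ ≤ dist x y₀ + ε + τ := by linarith [dist_triangle y' z y₀]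
      exact le_trans (by linarith [cone_mono (D := D) hK hΛ h3]) (hge y')
    have h3 : p * (Φ y₀ - 12 * L * ε - cone K Λ D (dist x y₀ - ε + τ)) ≤
      p * barrier Y Φ K Λ D ε y₀ y := by gcongr
    have h4 : (1 - p) * (Φ y₀ - 12 * L * ε - cone K Λ D (dist x y₀ + ε + τ)) ≤
      (1 - p) * barrier Y Φ K Λ D ε y₀ y' := by gcongr
    have h5 := hcone _ hd'
    have h7 := min_le_left δ (L * ε)
    linarith

/-! ### Approximation of the solution by strict subsolutions -/

/-- Standing assumptions: bounded length space, Lipschitz boundary values,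
and odds which are not too uneven. -/
structure Setting (Y : Set X) (Φ : X → ℝ) (K Λ D ε p : ℝ) : Prop where
  isLengthSpace : IsLengthSpace X
  nonempty : Y.Nonempty
  K_pos : 0 < K
  Λ_pos : 0 < Λ
  dist_le : ∀ x y : X, dist x y ≤ D
  ε_pos : 0 < ε
  le_p : 1 / 4 ≤ p
  le_q : 1 / 4 ≤ 1 - p
  odds : 1 - p < p * Real.exp (Λ * ε)
  odds' : p < (1 - p) * Real.exp (Λ * ε)
  lipschitz : ∀ y ∈ Y, ∀ y' ∈ Y, |Φ y - Φ y'| ≤ K * dist y y'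

/-- Exchanging the players swaps the two odds conditions, so each lower bound also yields an upper
bound. -/
theorem Setting.neg (h : Setting Y Φ K Λ D ε p) :
    Setting Y (fun x => -Φ x) K Λ D ε (1 - p) where
  isLengthSpace := h.isLengthSpace
  nonempty := h.nonempty
  K_pos := h.K_pos
  Λ_pos := h.Λ_pos
  dist_le := h.dist_le
  ε_pos := h.ε_pos
  le_p := h.le_q
  le_q := by simpa using h.le_p
  odds := by simpa using h.odds'
  odds' := by simpa using h.odds
  lipschitz y hy y' hy' := by
    rw [show -Φ y - -Φ y' = -(Φ y - Φ y') by ring, abs_neg]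
    exact h.lipschitz y hy y' hy'

theorem Setting.p_pos (h : Setting Y Φ K Λ D ε p) : 0 < p := by linarith [h.le_p]

theorem Setting.p_lt_one (h : Setting Y Φ K Λ D ε p) : p < 1 := by linarith [h.le_q]

theorem Setting.exists_bound (h : Setting Y Φ K Λ D ε p) : ∃ B, ∀ y ∈ Y, |Φ y| ≤ B := by
  obtain ⟨y₀, hy₀⟩ := h.nonempty
  refine ⟨|Φ y₀| + K * D, fun y hy => ?_⟩
  have h1 := h.lipschitz y hy y₀ hy₀
  have h2 : K * dist y y₀ ≤ K * D := mul_le_mul_of_nonneg_left (h.dist_le _ _) h.K_pos.le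
  have h3 := abs_sub_abs_le_abs_sub (Φ y) (Φ y₀)
  linarith

theorem Setting.exists_barrier_bound (h : Setting Y Φ K Λ D ε p) :
    ∃ B, ∀ y ∈ Y, ∀ x, |barrier Y Φ K Λ D ε y x| ≤ B := by
  obtain ⟨B, hB⟩ := h.exists_bound
  exact ⟨_, fun y hy x => abs_barrier_le h.K_pos h.Λ_pos h.ε_pos hB hy x⟩

theorem Setting.exists_isFavSub_barrier (h : Setting Y Φ K Λ D ε p) :
    ∃ δ > 0, ∀ y ∈ Y, IsFavSub Y ε p δ (barrier Y Φ K Λ D ε y) :=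
  TugOfWar.exists_isFavSub_barrier h.isLengthSpace h.K_pos h.Λ_pos h.dist_le h.ε_pos h.le_p
    h.p_lt_one h.odds h.lipschitz

/-- There are bounded strict sub- and supersolutions. -/
theorem Setting.exists_strict (h : Setting Y Φ K Λ D ε p) :
    ∃ δ > 0, ∃ B, ∀ w ∈ Y, ∃ L U : X → ℝ, (∀ x, |L x| ≤ B) ∧ (∀ x, |U x| ≤ B) ∧
      (∀ x, L x ≤ U x) ∧ (∀ y ∈ Y, L y = Φ y) ∧ (∀ y ∈ Y, U y = Φ y) ∧
      IsSub Y ε p δ L ∧ IsSuper Y ε p δ U ∧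
      ∀ x, U x ≤ Φ w + 12 * (K * Real.exp (Λ * D)) * ε + K * Real.exp (Λ * D) * dist x w := by
  obtain ⟨δ₁, hδ₁, h1⟩ := h.exists_isFavSub_barrier
  obtain ⟨B₁, hB₁⟩ := h.exists_barrier_bound
  obtain ⟨δ₂, hδ₂, h2⟩ := h.neg.exists_isFavSub_barrier
  obtain ⟨B₂, hB₂⟩ := h.neg.exists_barrier_bound
  refine ⟨min δ₁ δ₂, by positivity, max B₁ B₂, fun w hw => ?_⟩
  refine ⟨barrier Y Φ K Λ D ε w, fun x => -barrier Y (fun x => -Φ x) K Λ D ε w x,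
    fun x => (hB₁ w hw x).trans (le_max_left _ _),
    fun x => by rw [abs_neg]; exact (hB₂ w hw x).trans (le_max_right _ _), fun x => ?_,
    fun y hy => barrier_of_mem hy, fun y hy => by simp [barrier_of_mem hy], ?_, ?_,
    fun x => ?_⟩
  · by_cases hx : x ∈ Y
    · simp [barrier_of_mem hx]
    · beta_reduce
      rw [barrier_of_notMem hx, barrier_of_notMem hx]
      have h3 := cone_nonneg (D := D) h.K_pos h.Λ_pos (dist_nonneg (x := x) (y := w))
      have h4 : 0 ≤ 12 * (K * Real.exp (Λ * D)) * ε := by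
        have := h.K_pos; have := h.ε_pos; positivity
      linarith
  · exact ((h1 w hw).isSub h.ε_pos h.p_pos h.p_lt_one (hB₁ w hw)).mono (min_le_left _ _)
  · have := ((h2 w hw).isSub h.ε_pos h.neg.p_pos h.neg.p_lt_one (hB₂ w hw)).neg
    rw [sub_sub_cancel] at this
    exact this.mono (min_le_right _ _)
  · have h3 := barrier_ge h.K_pos h.Λ_pos h.dist_le h.ε_pos h.neg.lipschitz hw x
    have h4 := cone_le (D := D) h.K_pos h.Λ_pos (dist x w)
    beta_reduce
    linarith

/-- Solutions of the equation with a running cost `δ`, for all small `δ`. -/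
theorem Setting.exists_solutions (h : Setting Y Φ K Λ D ε p) :
    ∃ δ₁ > 0, ∃ B, ∀ δ, 0 ≤ δ → δ ≤ δ₁ → ∃ u : X → ℝ, (∀ x, |u x| ≤ B) ∧
      (∀ y ∈ Y, u y = Φ y) ∧ IsSub Y ε p δ u ∧ IsSuper Y ε p (-δ) u := by
  obtain ⟨δ₁, hδ₁, B, hB⟩ := h.exists_strict
  obtain ⟨w, hw⟩ := h.nonempty
  obtain ⟨L, U, hL, hU, hLU, hLY, hUY, hLs, hUs, -⟩ := hB w hw
  refine ⟨δ₁, hδ₁, B, fun δ hδ0 hδ => ?_⟩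
  obtain ⟨u, huB, huY, husub, husup⟩ := exists_solution h.ε_pos h.p_pos h.p_lt_one hL hU hLU
    (fun y hy => (hLY y hy).trans (hUY y hy).symm) (hLs.mono hδ) (hUs.mono (δ' := -δ) (by linarith))
  exact ⟨u, huB, fun y hy => (huY y hy).trans (hUY y hy), husub, husup⟩

/-- Subsolutions are close to the boundary values near `Y`. -/
theorem Setting.le_near_boundary (h : Setting Y Φ K Λ D ε p) {f : X → ℝ} {B : ℝ}
    (hf : ∀ x, |f x| ≤ B) (hfY : ∀ y ∈ Y, f y = Φ y) (hfs : IsSub Y ε p 0 f) {w x : X}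
    (hw : w ∈ Y) (hxw : dist x w < 3 * ε) :
    f x ≤ Φ w + 15 * (K * Real.exp (Λ * D)) * ε := by
  obtain ⟨δ₁, hδ₁, B', hB'⟩ := h.exists_strict
  obtain ⟨L, U, -, hU, -, -, hUY, -, hUs, hUw⟩ := hB' w hw
  have h1 := hfs.le_of_isSuper h.isLengthSpace h.dist_le h.nonempty h.ε_pos h.p_pos h.p_lt_one
    hf hU (hUs.mono hδ₁.le) (fun y hy => by rw [hfY y hy, hUY y hy]) x
  have h2 := hUw x
  -- The 15 is the jump 12 of the barrier plus the radius 3.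
  have h3 : K * Real.exp (Λ * D) * dist x w ≤ K * Real.exp (Λ * D) * (3 * ε) := by
    have := h.K_pos
    gcongr
  linarith

/-- A strict subsolution for the favored game which is not much smaller than a given strict
subsolution for the ordinary game. -/
theorem Setting.exists_isFavSub (h : Setting Y Φ K Λ D ε p) {f : X → ℝ} {B δ : ℝ}
    (hf : ∀ x, |f x| ≤ B) (hfY : ∀ y ∈ Y, f y = Φ y) (hδ : 0 < δ) (hfs : IsSub Y ε p δ f) :
    ∃ (g : X → ℝ) (δ' B' : ℝ), 0 < δ' ∧ (∀ x, |g x| ≤ B') ∧ (∀ y ∈ Y, g y = Φ y) ∧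
      IsFavSub Y ε p δ' g ∧ ∀ x, f x - 15 * (K * Real.exp (Λ * D)) * ε ≤ g x := by
  classical
  obtain ⟨δ₁, hδ₁, hbar⟩ := h.exists_isFavSub_barrier
  obtain ⟨B₁, hB₁⟩ := h.exists_barrier_bound
  obtain ⟨BΦ, hBΦ⟩ := h.exists_bound
  have hε := h.ε_pos
  have hp := h.p_pos
  have hq : 0 < 1 - p := by linarith [h.le_q]
  have hKpos := h.K_pos
  have hfnear := fun {w x : X} => h.le_near_boundary hf hfY (hfs.mono hδ.le) (w := w) (x := x)
  set C := 15 * (K * Real.exp (Λ * D)) * ε with hC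
  have hCpos : 0 < C := by positivity
  obtain ⟨w₀, hw₀⟩ := h.nonempty
  have : Nonempty Y := ⟨⟨w₀, hw₀⟩⟩
  set P : X → ℝ := fun x => ⨆ w : Y, barrier Y Φ K Λ D ε w x with hP
  have hbP : ∀ w ∈ Y, ∀ x, barrier Y Φ K Λ D ε w x ≤ P x := fun w hw x =>
    le_ciSup (f := fun w : Y => barrier Y Φ K Λ D ε w x)
      ⟨B₁, by rintro _ ⟨w, rfl⟩; exact (abs_le.1 (hB₁ w w.2 x)).2⟩ ⟨w, hw⟩
  have hPB : ∀ x, |P x| ≤ B₁ := fun x => abs_le.2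
    ⟨(abs_le.1 (hB₁ w₀ hw₀ x)).1.trans (hbP w₀ hw₀ x),
      ciSup_le fun w => (abs_le.1 (hB₁ w w.2 x)).2⟩
  have hPY : ∀ y ∈ Y, P y = Φ y := fun y hy => by
    simp only [hP, barrier_of_mem hy, ciSup_const]
  set G : X → ℝ := supBall ε f with hG
  have hfG : ∀ x z, dist z x < ε → f z ≤ G x := fun x z hz => le_supBall hf hz
  have hGB : ∀ x, |G x| ≤ B := fun x => abs_le.2
    ⟨(abs_le.1 (hf x)).1.trans (hfG x x (by simpa using hε)),
      supBall_le hε fun z _ => (abs_le.1 (hf z)).2⟩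
  have hGw : ∀ w ∈ Y, ∀ x, dist x w < 2 * ε → G x - C ≤ Φ w := fun w hw x hx => by
    have : G x ≤ Φ w + C := supBall_le hε fun z hz =>
      hfnear hw (by linarith [dist_triangle z x w])
    linarith
  -- The barrier envelope `P` takes over where the almost maximizers of `f` may lie in `Y`, at which
  -- `f` satisfies no equation.
  set g : X → ℝ := fun x => if x ∈ Y then Φ x else max (P x) (G x - C) with hg
  have hgY : ∀ y ∈ Y, g y = Φ y := fun y hy => if_pos hy
  have hgnY : ∀ x ∉ Y, g x = max (P x) (G x - C) := fun x hx => if_neg hx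
  have hPg : ∀ x, P x ≤ g x := fun x => by
    by_cases hx : x ∈ Y
    · rw [hgY x hx, hPY x hx]
    · rw [hgnY x hx]; exact le_max_left _ _
  have hGg : ∀ x, G x - C ≤ g x := fun x => by
    by_cases hx : x ∈ Y
    · rw [hgY x hx]; exact hGw x hx x (by simpa using hε)
    · rw [hgnY x hx]; exact le_max_right _ _
  refine ⟨g, min δ₁ δ / 2, max B₁ (max BΦ B), by positivity, fun x => ?_, hgY, ?_,
    fun x => le_trans (by linarith [hfG x x (by simpa using hε)]) (hGg x)⟩
  · refine abs_le.2 ⟨?_, ?_⟩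
    · have := (abs_le.1 (hPB x)).1
      linarith [hPg x, le_max_left B₁ (max BΦ B)]
    · by_cases hx : x ∈ Y
      · rw [hgY x hx]
        exact (abs_le.1 (hBΦ x hx)).2.trans ((le_max_left _ _).trans (le_max_right _ _))
      · rw [hgnY x hx]
        refine max_le ((abs_le.1 (hPB x)).2.trans (le_max_left _ _)) ?_
        have := (abs_le.1 (hGB x)).2
        have h2 : B ≤ max B₁ (max BΦ B) := (le_max_right _ _).trans (le_max_right _ _)
        linarith
  intro x hx
  have hm1 := min_le_left δ₁ δ
  have hm2 := min_le_right δ₁ δ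
  rw [hgnY x hx]
  rcases le_or_gt (G x - C) (P x) with hcase | hcase
  · rw [max_eq_left hcase]
    obtain ⟨⟨w, hw⟩, hwx⟩ := exists_lt_of_lt_ciSup (show P x - δ₁ / 2 < P x by linarith)
    obtain ⟨z, hz, hzy⟩ := hbar w hw x hx
    refine ⟨z, hz, fun y y' hy hy' => ?_⟩
    have h1 := hzy y y' hy hy'
    have h2 : p * barrier Y Φ K Λ D ε w y ≤ p * g y := by
      gcongr; exact (hbP w hw y).trans (hPg y)
    have h3 : (1 - p) * barrier Y Φ K Λ D ε w y' ≤ (1 - p) * g y' := by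
      gcongr; exact (hbP w hw y').trans (hPg y')
    simp only at hwx
    linarith
  · rw [max_eq_right hcase.le]
    obtain ⟨y, hy, hfy⟩ := exists_lt_of_lt_supBall hε
      (show max (G x - δ / 2) (P x + C) < supBall ε f x from
        max_lt (by change _ < G x; linarith) (by change _ < G x; linarith))
    have hfy1 := (le_max_left (G x - δ / 2) (P x + C)).trans_lt hfy
    have hfy2 := (le_max_right (G x - δ / 2) (P x + C)).trans_lt hfy
    -- If `y` were in `Y`, its own barrier would give `P x ≥ Φ y - 13 * L * ε` with `L = K * exp (Λ
    -- * D)`, contradicting `P x + C < f y = Φ y`.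
    have hyY : y ∉ Y := fun hyY => by
      have h1 := hbP y hyY x
      rw [barrier_of_notMem hx] at h1
      have h2 := cone_le (D := D) hKpos h.Λ_pos (dist x y)
      have h3 : K * Real.exp (Λ * D) * dist x y ≤ K * Real.exp (Λ * D) * ε := by
        rw [dist_comm] at hy
        gcongr
      rw [hfY y hyY] at hfy2
      have : 0 < K * Real.exp (Λ * D) * ε := by positivity
      linarith
    refine ⟨y, hy, fun z z' hz hz' => ?_⟩
    have h1 : supBall ε f y - C ≤ g z := by
      rcases hz with ⟨hz, hzY⟩ | rfl
      · rw [hgY z hzY]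
        exact hGw z hzY y (by rwa [dist_comm])
      · exact hGg z
    have h2 : infBall ε f y - C ≤ g z' := by
      -- A midpoint of the target and the favored player's move: `G z' ≥ f v ≥ infBall ε f y`.
      obtain ⟨v, hvy, hvz⟩ := h.isLengthSpace.exists_between (x := y) (y := z') hε hε
        (by rw [dist_comm]; linarith)
      linarith [hGg z', hfG z' v hvz, infBall_le hf hvy]
    have h3 : p * (supBall ε f y - C) ≤ p * g z := by gcongr
    have h4 : (1 - p) * (infBall ε f y - C) ≤ (1 - p) * g z' := by gcongr
    have h5 := hfs y hyY
    linarith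

/-- A solution can be approximated from below by strict subsolutions for both games. -/
theorem Setting.exists_strict_approx (h : Setting Y Φ K Λ D ε p) {u : X → ℝ} {B : ℝ}
    (hu : ∀ x, |u x| ≤ B) (huY : ∀ y ∈ Y, u y = Φ y) (hus : IsSub Y ε p 0 u) {η : ℝ}
    (hη : 0 < η) :
    (∃ (g : X → ℝ) (δ B' : ℝ), 0 < δ ∧ (∀ x, |g x| ≤ B') ∧ (∀ y ∈ Y, g y = Φ y) ∧
      IsSub Y ε p δ g ∧ ∀ x, u x - η ≤ g x) ∧
    ∃ (g : X → ℝ) (δ B' : ℝ), 0 < δ ∧ (∀ x, |g x| ≤ B') ∧ (∀ y ∈ Y, g y = Φ y) ∧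
      IsFavSub Y ε p δ g ∧ ∀ x, u x - 15 * (K * Real.exp (Λ * D)) * ε - η ≤ g x := by
  obtain ⟨δ₁, hδ₁, B', hsol⟩ := h.exists_solutions
  -- The tolerance is fixed before the solution with running cost is chosen, which its uniformity in
  -- `g` permits.
  obtain ⟨δ₀, hδ₀, hcomp⟩ := hus.le_add_of_isSuper h.isLengthSpace h.dist_le h.nonempty h.ε_pos
    h.p_pos h.p_lt_one (B := max B B') (fun x => (hu x).trans (le_max_left _ _)) hη
  have hδ : 0 < min δ₀ δ₁ := lt_min hδ₀ hδ₁
  obtain ⟨f, hf, hfY, hfs, hfs'⟩ := hsol _ hδ.le (min_le_right _ _)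
  have huf := hcomp _ (min_le_left _ _) f (fun x => (hf x).trans (le_max_right _ _)) hfs'
    (fun y hy => by rw [huY y hy, hfY y hy])
  refine ⟨⟨f, _, _, hδ, hf, hfY, hfs, fun x => by linarith [huf x]⟩, ?_⟩
  obtain ⟨g, δ', B'', hδ', hg, hgY, hgs, hfg⟩ := h.exists_isFavSub hf hfY hδ hfs
  exact ⟨g, δ', B'', hδ', hg, hgY, hgs, fun x => by linarith [huf x, hfg x]⟩

end Barrier

/-! ### Strategies -/

section Payoff

variable {X : Type*} {Y : Set X} {F : Y → ℝ} {r : ℝ} {x : (ℕ → Bool) → ℕ → X} {c : ℝ}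

theorem payoffMinus_eq (h : TerminatesAS Y r x) :
    payoffMinus Y F r x = ((∫ ω, payoff Y F (x ω) ∂(tosses r) : ℝ) : EReal) := if_pos h

theorem payoffPlus_eq (h : TerminatesAS Y r x) :
    payoffPlus Y F r x = ((∫ ω, payoff Y F (x ω) ∂(tosses r) : ℝ) : EReal) := if_pos h

theorem payoffMinus_le_payoffPlus : payoffMinus Y F r x ≤ payoffPlus Y F r x := by
  by_cases h : TerminatesAS Y r x
  · rw [payoffMinus_eq h, payoffPlus_eq h]
  · rw [payoffMinus, if_neg h]
    exact bot_le

end Payoff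

section Ordinary

variable {X : Type*} [MetricSpace X] {Y : Set X} {F : Y → ℝ} {r ε δ B : ℝ} {g : X → ℝ} {x₀ : X}

theorem dependsOn_history (S T : Strategy ε x₀) (n : ℕ) :
    DependsOn (fun ω => history S T ω n) (Set.Iio n) := by
  induction n with
  | zero => intro ω ω' _; rfl
  | succ n ih =>
    intro ω ω' h
    have h1 : history S T ω n = history S T ω' n := ih fun i hi => h i (Nat.lt_succ_of_lt hi)
    have h2 : ω n = ω' n := h n (Nat.lt_succ_self n)
    simp only [history, h1, h2]

theorem dependsOn_trajectory (S T : Strategy ε x₀) (n : ℕ) :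
    DependsOn (fun ω => trajectory S T ω n) (Set.Iio n) := fun _ _ h =>
  congrArg (position x₀) (dependsOn_history S T n h)

theorem history_update (S T : Strategy ε x₀) (ω : ℕ → Bool) (n : ℕ) (c : Bool) :
    history S T (Function.update ω n c) n = history S T ω n :=
  dependsOn_history S T n fun _ hi => Function.update_of_ne (ne_of_lt hi) _ _

theorem trajectory_update_true (S T : Strategy ε x₀) (ω : ℕ → Bool) (n : ℕ) :
    trajectory S T (Function.update ω n true) (n + 1) = S.move (history S T ω n) := by
  simp [trajectory, history, position, history_update]

theorem trajectory_update_false (S T : Strategy ε x₀) (ω : ℕ → Bool) (n : ℕ) :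
    trajectory S T (Function.update ω n false) (n + 1) = T.move (history S T ω n) := by
  simp [trajectory, history, position, history_update]

/-- The strategy that moves from `x` to `s x`. -/
def Strategy.ofMap (x₀ : X) (s : X → X) (hs : ∀ x, dist (s x) x < ε) : Strategy ε x₀ where
  move h := s (position x₀ h)
  legal _ := hs _

theorem odds_pos (hr : 0 < r) : 0 < r / (r + 1) := by positivity

theorem odds_lt_one (hr : 0 < r) : r / (r + 1) < 1 := by
  rw [div_lt_one (by positivity)]
  linarith

theorem IsSub.exists_map {p : ℝ} (hε : 0 < ε) (hp : 0 < p) (hp1 : p < 1) (hδ : 0 < δ)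
    (hB : ∀ x, |g x| ≤ B) (h : IsSub Y ε p δ g) :
    ∃ s : X → X, (∀ x, dist (s x) x < ε) ∧ ∀ x ∉ Y, ∀ y, dist y x < ε →
      g x + δ / 2 ≤ p * g (s x) + (1 - p) * g y := by
  have : ∀ x, ∃ z, dist z x < ε ∧ (x ∉ Y → ∀ y, dist y x < ε →
      g x + δ / 2 ≤ p * g z + (1 - p) * g y) := fun x => by
    by_cases hx : x ∈ Y
    · exact ⟨x, by simpa using hε, fun h => absurd hx h⟩
    · obtain ⟨z, hz, h1⟩ := h.exists_move hε hp hp1 hδ hB hx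
      exact ⟨z, hz, fun _ => h1⟩
  choose s hs hs' using this
  exact ⟨s, hs, hs'⟩

/-- An almost optimal move chosen from the current position alone makes `g` drift upwards by `δ / 2`
per step, whatever the opponent does. -/
theorem le_valueI (hr : 0 < r) (hε : 0 < ε) (hδ : 0 < δ) (hgF : ∀ y : Y, g y = F y)
    (hB : ∀ x, |g x| ≤ B) (hg : IsSub Y ε (r / (r + 1)) δ g) (x : X) :
    (g x : EReal) ≤ valueI Y F r ε x := by
  obtain ⟨s, hs, hs'⟩ := hg.exists_map hε (odds_pos hr) (odds_lt_one hr) hδ hB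
  refine le_iSup_of_le (Strategy.ofMap x s hs) (le_iInf fun T => ?_)
  obtain ⟨h1, h2⟩ := terminatesAS_and_le_integral hr (x := trajectory (Strategy.ofMap x s hs) T)
    (x₀ := x) (fun ω => rfl) (dependsOn_trajectory _ T) hgF hB (half_pos hδ) fun ω n hn => by
      rw [trajectory_update_true, trajectory_update_false]
      exact hs' _ hn _ (T.legal _)
  rw [payoffMinus_eq h1]
  exact_mod_cast h2

theorem valueII_le (hr : 0 < r) (hε : 0 < ε) (hδ : 0 < δ) (hgF : ∀ y : Y, g y = F y)
    (hB : ∀ x, |g x| ≤ B) (hg : IsSuper Y ε (r / (r + 1)) δ g) (x : X) :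
    valueII Y F r ε x ≤ (g x : EReal) := by
  obtain ⟨s, hs, hs'⟩ := hg.neg.exists_map hε (by linarith [odds_lt_one hr])
    (by linarith [odds_pos hr]) hδ (B := B) (fun x => by rw [abs_neg]; exact hB x)
  refine iInf_le_of_le (Strategy.ofMap x s hs) (iSup_le fun S => ?_)
  obtain ⟨h1, h2⟩ := terminatesAS_and_integral_le hr (x := trajectory S (Strategy.ofMap x s hs))
    (x₀ := x) (fun ω => rfl) (dependsOn_trajectory S _) hgF hB (half_pos hδ) fun ω n hn => by
      rw [trajectory_update_true, trajectory_update_false]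
      have h3 := hs' _ hn _ (S.legal (history S (Strategy.ofMap x s hs) ω n))
      change _ * g _ + _ * g (s (trajectory S (Strategy.ofMap x s hs) ω n)) + _ ≤ _
      linarith
  rw [payoffPlus_eq h1]
  exact_mod_cast h2

theorem valueI_le_valueII (Y : Set X) (F : Y → ℝ) (r ε : ℝ) (x : X) :
    valueI Y F r ε x ≤ valueII Y F r ε x :=
  iSup_le fun S => le_iInf fun T =>
    (iInf_le _ T).trans (payoffMinus_le_payoffPlus.trans (le_iSup_of_le S le_rfl))

end Ordinary

section Favored

variable {X : Type*} [MetricSpace X] {Y : Set X} {F : Y → ℝ} {r ε δ B : ℝ} {g : X → ℝ} {x₀ : X}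
  {aimer : Bool}

theorem dependsOn_favHistory (S : AimerStrategy ε x₀) (T : FavoredStrategy Y ε aimer) (n : ℕ) :
    DependsOn (fun ω => favHistory S T ω n) (Set.Iio n) := by
  induction n with
  | zero => intro ω ω' _; rfl
  | succ n ih =>
    intro ω ω' h
    have h1 : favHistory S T ω n = favHistory S T ω' n :=
      ih fun i hi => h i (Nat.lt_succ_of_lt hi)
    have h2 : ω n = ω' n := h n (Nat.lt_succ_self n)
    simp only [favHistory, h1, h2]

theorem dependsOn_favTrajectory (S : AimerStrategy ε x₀) (T : FavoredStrategy Y ε aimer) (n : ℕ) :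
    DependsOn (fun ω => favTrajectory S T ω n) (Set.Iio n) := fun _ _ h =>
  congrArg (favPosition x₀) (dependsOn_favHistory S T n h)

theorem favTrajectory_update (S : AimerStrategy ε x₀) (T : FavoredStrategy Y ε aimer)
    (ω : ℕ → Bool) (n : ℕ) (c : Bool) :
    favTrajectory S T (Function.update ω n c) (n + 1) =
      T.move (favHistory S T ω n) (S.target (favHistory S T ω n)) c := by
  have : favHistory S T (Function.update ω n c) n = favHistory S T ω n :=
    dependsOn_favHistory S T n fun _ hi => Function.update_of_ne (ne_of_lt hi) _ _
  simp [favTrajectory, favHistory, favPosition, this]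

/-- The strategy that aims at `s x` from `x`. -/
def AimerStrategy.ofMap (x₀ : X) (s : X → X) (hs : ∀ x, dist (s x) x < ε) :
    AimerStrategy ε x₀ where
  target h := s (favPosition x₀ h)
  legal _ := hs _

/-- The strategy that accepts each target `z`, and moves to `τ z` after winning the toss. -/
def FavoredStrategy.ofMap (Y : Set X) (aimer : Bool) (τ : X → X)
    (hτ : ∀ z, dist (τ z) z < 2 * ε) : FavoredStrategy Y ε aimer where
  move _ z c := if c = aimer then z else τ z
  legal_aimer_wins _ _ _ hc := Or.inr (if_pos hc)
  legal_favored_wins _ z _ hc := by rw [if_neg hc]; exact hτ z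

theorem IsFavSub.exists_map {p : ℝ} (hε : 0 < ε) (h : IsFavSub Y ε p δ g) :
    ∃ s : X → X, (∀ x, dist (s x) x < ε) ∧ ∀ x ∉ Y, ∀ y y',
      ((dist y (s x) < 2 * ε ∧ y ∈ Y) ∨ y = s x) → dist y' (s x) < 2 * ε →
        g x + δ ≤ p * g y + (1 - p) * g y' := by
  have : ∀ x, ∃ z, dist z x < ε ∧ (x ∉ Y → ∀ y y', ((dist y z < 2 * ε ∧ y ∈ Y) ∨ y = z) →
      dist y' z < 2 * ε → g x + δ ≤ p * g y + (1 - p) * g y') := fun x => by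
    by_cases hx : x ∈ Y
    · exact ⟨x, by simpa using hε, fun h => absurd hx h⟩
    · obtain ⟨z, hz, h1⟩ := h x hx
      exact ⟨z, hz, fun _ => h1⟩
  choose s hs hs' using this
  exact ⟨s, hs, hs'⟩

/-- A favored maximizing player does at least as well as in the ordinary game. -/
theorem IsSub.exists_favored_map {p : ℝ} (hε : 0 < ε) (hp : 0 < p) (hp1 : p < 1) (hδ : 0 < δ)
    (hB : ∀ x, |g x| ≤ B) (h : IsSub Y ε p δ g) :
    ∃ τ : X → X, (∀ z, dist (τ z) z < 2 * ε) ∧ ∀ x ∉ Y, ∀ z, dist z x < ε →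
      g x + δ / 2 ≤ p * g (τ z) + (1 - p) * g z := by
  have : ∀ z, ∃ w, dist w z < 2 * ε ∧ supBall (2 * ε) g z - δ / 2 < g w := fun z =>
    exists_lt_of_lt_supBall (by positivity) (by linarith)
  choose τ hτ hτ' using this
  refine ⟨τ, hτ, fun x hx z hz => ?_⟩
  have h1 : supBall ε g x ≤ supBall (2 * ε) g z := supBall_le hε fun y hy =>
    le_supBall hB (by linarith [dist_triangle_right y z x])
  have h2 : p * supBall ε g x ≤ p * (g (τ z) + δ / 2) := by
    gcongr
    linarith [hτ' z]
  have h3 : (1 - p) * infBall ε g x ≤ (1 - p) * g z :=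
    mul_le_mul_of_nonneg_left (infBall_le hB hz) (by linarith)
  have h4 : p * (δ / 2) ≤ δ / 2 := by nlinarith
  linarith [h x hx]

theorem le_valueIIFavored (hr : 0 < r) (hε : 0 < ε) (hδ : 0 < δ) (hgF : ∀ y : Y, g y = F y)
    (hB : ∀ x, |g x| ≤ B) (hg : IsFavSub Y ε (r / (r + 1)) δ g) (x : X) :
    (g x : EReal) ≤ valueIIFavored Y F r ε x := by
  obtain ⟨s, hs, hs'⟩ := hg.exists_map hε
  refine le_iSup_of_le (AimerStrategy.ofMap x s hs) (le_iInf fun T => ?_)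
  obtain ⟨h1, h2⟩ := terminatesAS_and_le_integral hr
    (x := favTrajectory (AimerStrategy.ofMap x s hs) T)
    (x₀ := x) (fun ω => rfl) (dependsOn_favTrajectory _ T) hgF hB hδ fun ω n hn => by
      rw [favTrajectory_update, favTrajectory_update]
      exact hs' _ hn _ _ (T.legal_aimer_wins _ _ _ rfl)
        (T.legal_favored_wins _ _ _ Bool.false_ne_true)
  rw [payoffMinus_eq h1]
  exact_mod_cast h2

theorem valueIFavored_le (hr : 0 < r) (hε : 0 < ε) (hδ : 0 < δ) (hgF : ∀ y : Y, g y = F y)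
    (hB : ∀ x, |g x| ≤ B) (hg : IsFavSub Y ε (1 - r / (r + 1)) δ fun x => -g x) (x : X) :
    valueIFavored Y F r ε x ≤ (g x : EReal) := by
  obtain ⟨s, hs, hs'⟩ := hg.exists_map hε
  refine iInf_le_of_le (AimerStrategy.ofMap x s hs) (iSup_le fun T => ?_)
  obtain ⟨h1, h2⟩ := terminatesAS_and_integral_le hr
    (x := favTrajectory (AimerStrategy.ofMap x s hs) T)
    (x₀ := x) (fun ω => rfl) (dependsOn_favTrajectory _ T) hgF hB hδ fun ω n hn => by
      rw [favTrajectory_update, favTrajectory_update]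
      have h3 := hs' _ hn _ _ (T.legal_aimer_wins (favHistory (AimerStrategy.ofMap x s hs) T ω n)
        _ _ rfl) (T.legal_favored_wins (favHistory (AimerStrategy.ofMap x s hs) T ω n) _ _
          Bool.false_ne_true.symm)
      change _ * g (T.move _ (s (favTrajectory (AimerStrategy.ofMap x s hs) T ω n)) _) +
        _ * g (T.move _ (s (favTrajectory (AimerStrategy.ofMap x s hs) T ω n)) _) + _ ≤ _
      linarith
  rw [payoffPlus_eq h1]
  exact_mod_cast h2

theorem le_valueIFavored (hr : 0 < r) (hε : 0 < ε) (hδ : 0 < δ) (hgF : ∀ y : Y, g y = F y)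
    (hB : ∀ x, |g x| ≤ B) (hg : IsSub Y ε (r / (r + 1)) δ g) (x : X) :
    (g x : EReal) ≤ valueIFavored Y F r ε x := by
  obtain ⟨τ, hτ, hτ'⟩ := hg.exists_favored_map hε (odds_pos hr) (odds_lt_one hr) hδ hB
  refine le_iInf fun S => le_iSup_of_le (FavoredStrategy.ofMap Y false τ hτ) ?_
  obtain ⟨h1, h2⟩ := terminatesAS_and_le_integral hr
    (x := favTrajectory S (FavoredStrategy.ofMap Y false τ hτ))
    (x₀ := x) (fun ω => rfl) (dependsOn_favTrajectory S _) hgF hB (half_pos hδ) fun ω n hn => by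
      rw [favTrajectory_update, favTrajectory_update]
      exact hτ' _ hn _ (S.legal _)
  rw [payoffPlus_eq h1]
  exact_mod_cast h2

theorem valueIIFavored_le (hr : 0 < r) (hε : 0 < ε) (hδ : 0 < δ) (hgF : ∀ y : Y, g y = F y)
    (hB : ∀ x, |g x| ≤ B) (hg : IsSuper Y ε (r / (r + 1)) δ g) (x : X) :
    valueIIFavored Y F r ε x ≤ (g x : EReal) := by
  obtain ⟨τ, hτ, hτ'⟩ := hg.neg.exists_favored_map hε (by linarith [odds_lt_one hr])
    (by linarith [odds_pos hr]) hδ (B := B) (fun x => by rw [abs_neg]; exact hB x)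
  refine iSup_le fun S => iInf_le_of_le (FavoredStrategy.ofMap Y true τ hτ) ?_
  obtain ⟨h1, h2⟩ := terminatesAS_and_integral_le hr
    (x := favTrajectory S (FavoredStrategy.ofMap Y true τ hτ))
    (x₀ := x) (fun ω => rfl) (dependsOn_favTrajectory S _) hgF hB (half_pos hδ) fun ω n hn => by
      rw [favTrajectory_update, favTrajectory_update]
      have h3 := hτ' _ hn _ (S.legal (favHistory S (FavoredStrategy.ofMap Y true τ hτ) ω n))
      change _ * g (S.target _) + _ * g (τ (S.target _)) + _ ≤ _
      linarith
  rw [payoffMinus_eq h1]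
  exact_mod_cast h2

end Favored

/-! ### Comparison of the values -/

section Values

theorem exists_real_of_bounds {a b : ℝ} {v : EReal} (h1 : (a : EReal) ≤ v) (h2 : v ≤ (b : EReal)) :
    ∃ c : ℝ, v = (c : EReal) ∧ a ≤ c ∧ c ≤ b := by
  obtain ⟨c, rfl⟩ : ∃ c : ℝ, v = (c : EReal) := ⟨v.toReal, (EReal.coe_toReal
    (ne_top_of_le_ne_top (EReal.coe_ne_top b) h2) (ne_bot_of_le_ne_bot (EReal.coe_ne_bot a) h1)).symm⟩
  exact ⟨c, rfl, by exact_mod_cast h1, by exact_mod_cast h2⟩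

theorem coe_le_of_forall_sub_le {a : ℝ} {v : EReal} (h : ∀ η > 0, ((a - η : ℝ) : EReal) ≤ v) :
    (a : EReal) ≤ v := by
  induction v with
  | bot => exact absurd (h 1 one_pos) (not_le.2 (EReal.bot_lt_coe _))
  | top => exact le_top
  | coe c =>
    refine EReal.coe_le_coe_iff.2 (le_of_forall_pos_le_add fun η hη => ?_)
    linarith [EReal.coe_le_coe_iff.1 (h η hη)]

theorem le_coe_of_forall_le_add {a : ℝ} {v : EReal} (h : ∀ η > 0, v ≤ ((a + η : ℝ) : EReal)) :
    v ≤ (a : EReal) := by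
  induction v with
  | bot => exact bot_le
  | top => exact absurd (h 1 one_pos) (not_le.2 (EReal.coe_lt_top _))
  | coe c =>
    refine EReal.coe_le_coe_iff.2 (le_of_forall_pos_le_add fun η hη => ?_)
    exact EReal.coe_le_coe_iff.1 (h η hη)

variable {X : Type*} [MetricSpace X] {Y : Set X} {Φ : X → ℝ} {F : Y → ℝ} {K Λ D ε r : ℝ}

/-- Strict approximations of the solution `u` from both sides squeeze the two ordinary values to `u`
and give `u - C ≤ v ≤ u ≤ w ≤ u + C` for the favored ones, with `C` the error bound. -/
theorem Setting.exists_values (h : Setting Y Φ K Λ D ε (r / (r + 1))) (hr : 0 < r)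
    (hF : ∀ y : Y, Φ y = F y) :
    ∃ u v w : X → ℝ, (∀ x, valueI Y F r ε x = (u x : EReal)) ∧
      (∀ x, valueII Y F r ε x = (u x : EReal)) ∧
      (∀ x, valueIIFavored Y F r ε x = (v x : EReal)) ∧
      (∀ x, valueIFavored Y F r ε x = (w x : EReal)) ∧
      (∀ x, |v x - u x| ≤ 15 * (K * Real.exp (Λ * D)) * ε) ∧
      ∀ x, |w x - u x| ≤ 15 * (K * Real.exp (Λ * D)) * ε := by
  have hε := h.ε_pos
  obtain ⟨δ₁, hδ₁, B, hsol⟩ := h.exists_solutions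
  obtain ⟨u, hu, huY, hus, hus'⟩ := hsol 0 le_rfl hδ₁.le
  rw [neg_zero] at hus'
  have hlow := fun {η : ℝ} (hη : 0 < η) => h.exists_strict_approx hu huY hus hη
  have hupp := fun {η : ℝ} (hη : 0 < η) => h.neg.exists_strict_approx (u := fun x => -u x)
    (fun x => by rw [abs_neg]; exact hu x) (fun y hy => by rw [huY y hy]) hus'.neg hη
  set C := 15 * (K * Real.exp (Λ * D)) * ε with hC
  have h1 : ∀ x, (u x : EReal) ≤ valueI Y F r ε x := fun x => coe_le_of_forall_sub_le fun η hη => by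
    obtain ⟨⟨g, δ, B', hδ, hg, hgY, hgs, hug⟩, -⟩ := hlow hη
    exact (EReal.coe_le_coe_iff.2 (hug x)).trans
      (le_valueI hr hε hδ (fun y => (hgY y y.2).trans (hF y)) hg hgs x)
  have h2 : ∀ x, (u x : EReal) ≤ valueIFavored Y F r ε x := fun x =>
    coe_le_of_forall_sub_le fun η hη => by
      obtain ⟨⟨g, δ, B', hδ, hg, hgY, hgs, hug⟩, -⟩ := hlow hη
      exact (EReal.coe_le_coe_iff.2 (hug x)).trans
        (le_valueIFavored hr hε hδ (fun y => (hgY y y.2).trans (hF y)) hg hgs x)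
  have h3 : ∀ x, ((u x - C : ℝ) : EReal) ≤ valueIIFavored Y F r ε x := fun x =>
    coe_le_of_forall_sub_le fun η hη => by
      obtain ⟨-, ⟨g, δ, B', hδ, hg, hgY, hgs, hug⟩⟩ := hlow hη
      exact (EReal.coe_le_coe_iff.2 (hug x)).trans
        (le_valueIIFavored hr hε hδ (fun y => (hgY y y.2).trans (hF y)) hg hgs x)
  have h4 : ∀ x, valueII Y F r ε x ≤ (u x : EReal) := fun x => le_coe_of_forall_le_add fun η hη => by
    obtain ⟨⟨g, δ, B', hδ, hg, hgY, hgs, hug⟩, -⟩ := hupp hη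
    have hgs' := hgs.neg
    rw [sub_sub_cancel] at hgs'
    refine (valueII_le hr hε hδ (fun y => ?_) (B := B') (fun x => ?_) hgs' x).trans
      (EReal.coe_le_coe_iff.2 (by linarith [hug x]))
    · rw [hgY y y.2, neg_neg, hF]
    · rw [abs_neg]; exact hg x
  have h5 : ∀ x, valueIIFavored Y F r ε x ≤ (u x : EReal) := fun x =>
    le_coe_of_forall_le_add fun η hη => by
      obtain ⟨⟨g, δ, B', hδ, hg, hgY, hgs, hug⟩, -⟩ := hupp hη
      have hgs' := hgs.neg
      rw [sub_sub_cancel] at hgs'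
      refine (valueIIFavored_le hr hε hδ (fun y => ?_) (B := B') (fun x => ?_) hgs' x).trans
        (EReal.coe_le_coe_iff.2 (by linarith [hug x]))
      · rw [hgY y y.2, neg_neg, hF]
      · rw [abs_neg]; exact hg x
  have h6 : ∀ x, valueIFavored Y F r ε x ≤ ((u x + C : ℝ) : EReal) := fun x =>
    le_coe_of_forall_le_add fun η hη => by
      obtain ⟨-, ⟨g, δ, B', hδ, hg, hgY, hgs, hug⟩⟩ := hupp hη
      refine (valueIFavored_le hr hε hδ (g := fun x => -g x) (fun y => ?_) (B := B')
        (fun x => ?_) (by simpa using hgs) x).trans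
        (EReal.coe_le_coe_iff.2 (by linarith [hug x]))
      · rw [hgY y y.2, neg_neg, hF]
      · rw [abs_neg]; exact hg x
  choose v hv hv1 hv2 using fun x => exists_real_of_bounds (h3 x) (h5 x)
  choose w hw hw1 hw2 using fun x => exists_real_of_bounds (h2 x) (h6 x)
  have hCpos : 0 ≤ C := by
    have := h.K_pos
    positivity
  refine ⟨u, v, w, fun x => le_antisymm ((valueI_le_valueII Y F r ε x).trans (h4 x)) (h1 x),
    fun x => le_antisymm (h4 x) ((h1 x).trans (valueI_le_valueII Y F r ε x)), hv, hw,
    fun x => abs_le.2 ⟨by linarith [hv1 x], by linarith [hv2 x]⟩,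
    fun x => abs_le.2 ⟨by linarith [hw1 x], by linarith [hw2 x]⟩⟩

end Values

/-! ### Bounds on the odds and choice of constants -/

/-- An odds function of slope `β` lies between `1` and `1 + 2 β ε` for small `ε`. -/
theorem exists_odds_bounds {ρ : ℝ → ℝ} {β : ℝ} (hβ : 0 < β) (hρ0 : ρ 0 = 1)
    (hρ : HasDerivWithinAt ρ β (Set.Ici 0) 0) :
    ∃ ε₀ > 0, ∀ ε, 0 < ε → ε < ε₀ → 1 ≤ ρ ε ∧ ρ ε ≤ 1 + 2 * β * ε := by
  have h := (hasDerivWithinAt_iff_isLittleO.1 hρ).def hβ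
  rw [eventually_nhdsWithin_iff, Metric.eventually_nhds_iff] at h
  obtain ⟨ε₀, hε₀, h⟩ := h
  refine ⟨ε₀, hε₀, fun ε hε hε' => ?_⟩
  have h1 := h (y := ε) (by simpa [abs_of_pos hε] using hε') hε.le
  simp only [sub_zero, hρ0, smul_eq_mul, Real.norm_eq_abs, abs_of_pos hε] at h1
  have h2 := abs_le.1 h1
  constructor <;> linarith

end TugOfWar

theorem mainTheorem8 {X : Type*} [MetricSpace X] [CompactSpace X]
    (hX : TugOfWar.IsLengthSpace X) (Y : Set X) (hY : IsClosed Y) (hYne : Y.Nonempty)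
    (F : Y → ℝ) (hF : ∃ K : ℝ≥0, LipschitzWith K F) (β : ℝ) (hβ : 0 < β) :
    ∃ C : ℝ, 0 < C ∧
      ∀ ρ : ℝ → ℝ, (∀ ε, 0 < ε → 0 < ρ ε) → ρ 0 = 1 → HasDerivWithinAt ρ β (Set.Ici 0) 0 →
        ∃ ε₀ : ℝ, 0 < ε₀ ∧ ∀ ε : ℝ, 0 < ε → ε < ε₀ →
          ∃ u v w : X → ℝ,
            (∀ x, TugOfWar.valueI Y F (ρ ε) ε x = (u x : EReal)) ∧
            (∀ x, TugOfWar.valueII Y F (ρ ε) ε x = (u x : EReal)) ∧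
            (∀ x, TugOfWar.valueIIFavored Y F (ρ ε) ε x = (v x : EReal)) ∧
            (∀ x, TugOfWar.valueIFavored Y F (ρ ε) ε x = (w x : EReal)) ∧
            (∀ x, |v x - u x| ≤ C * ε) ∧
            (∀ x, |w x - u x| ≤ C * Real.sqrt ε) := by
  classical
  obtain ⟨K, hK⟩ := hF
  set D := Metric.diam (Set.univ : Set X)
  have hD : ∀ x y : X, dist x y ≤ D := fun x y =>
    Metric.dist_le_diam_of_mem isCompact_univ.isBounded (Set.mem_univ x) (Set.mem_univ y)
  -- The rate `Λ = 2 * β` works because `ρ ε ≤ 1 + 2 * β * ε < exp (Λ * ε)`; `K + 1` keeps the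
  -- Lipschitz constant positive. Only the threshold for `ε` depends on `ρ`.
  set C := 15 * (((K : ℝ) + 1) * Real.exp (2 * β * D)) with hC
  refine ⟨C, by positivity, fun ρ hρpos hρ0 hρ => ?_⟩
  obtain ⟨ε₁, hε₁, hodds⟩ := TugOfWar.exists_odds_bounds hβ hρ0 hρ
  -- `ε ≤ 1 / β` gives odds of at most 3, so both players win a toss with probability at least `1 /
  -- 4`; `ε ≤ 1` gives `ε ≤ √ε`.
  refine ⟨min ε₁ (min (1 / β) 1), by positivity, fun ε hε hεε => ?_⟩
  obtain ⟨h1, h2⟩ := hodds ε hε (hεε.trans_le (min_le_left _ _))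
  have hε1 : ε ≤ 1 := hεε.le.trans ((min_le_right _ _).trans (min_le_right _ _))
  have hεβ : ε * β ≤ 1 := by
    rw [← le_div_iff₀ hβ]
    exact hεε.le.trans ((min_le_right _ _).trans (min_le_left _ _))
  have hrpos := hρpos ε hε
  set r := ρ ε
  have hexp : r < Real.exp (2 * β * ε) := by
    have := Real.add_one_lt_exp (x := 2 * β * ε) (by positivity)
    linarith
  have hq : 1 - r / (r + 1) = 1 / (r + 1) := by field_simp; ring
  obtain ⟨Φ, hΦ⟩ : ∃ Φ : X → ℝ, ∀ y : Y, Φ y = F y :=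
    ⟨fun x => if h : x ∈ Y then F ⟨x, h⟩ else 0, fun y => by simp⟩
  have hS : TugOfWar.Setting Y Φ (K + 1) (2 * β) D ε (r / (r + 1)) :=
    { isLengthSpace := hX
      nonempty := hYne
      K_pos := by positivity
      Λ_pos := by positivity
      dist_le := hD
      ε_pos := hε
      le_p := by
        rw [le_div_iff₀ (by positivity)]
        linarith
      le_q := by
        rw [hq, le_div_iff₀ (by positivity)]
        linarith
      odds := by
        rw [hq, div_mul_eq_mul_div]
        gcongr
        nlinarith
      odds' := by
        rw [hq, div_mul_eq_mul_div, one_mul]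
        gcongr
      lipschitz := fun y hy y' hy' => by
        have h3 := hK.dist_le_mul ⟨y, hy⟩ ⟨y', hy'⟩
        rw [Real.dist_eq, ← hΦ, ← hΦ] at h3
        refine h3.trans ?_
        change (K : ℝ) * dist y y' ≤ _
        gcongr
        linarith }
  obtain ⟨u, v, w, hu, hu', hv, hw, hvu, hwu⟩ := hS.exists_values hrpos hΦ
  refine ⟨u, v, w, hu, hu', hv, hw, hvu, fun x => (hwu x).trans ?_⟩
  change C * ε ≤ C * Real.sqrt ε
  gcongr
  exact Real.le_sqrt_of_sq_le (by nlinarith)
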